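/- Let $E$ be a field, let $\tilde K=\bigcup_{n\ge 1}E((t^{-1/n}))$ be the Puiseux field with the valuation $\nu$ normalised by $\nu(t^{r})=-r$, let $\hat K$ be its completion, and put $\deg=-\nu$. Let $\bar A\subset\hat K$ be the ring of Puiseux polynomials, i.e. of finite sums $\sum_i a_it^{r_i}$ with $a_i\in E$, $r_i\in\mathbb{Q}_{\ge 0}$, and let $\tilde k=\mathrm{Quot}(\bar A)\subset\hat K$. Continued fraction. For every $z\in\hat K$ there is a unique $f\in\bar A$ with $\nu(z-f)>0$. For $a\in\hat K$ put $z_0=a$; given $z_n$, let $f_n\in\bar A$ be the element with $\nu(z_n-f_n)>0$; if $z_n\ne f_n$ put $z_{n+1}=1/(z_n-f_n)$, and if $z_n=f_n$ the continued fraction $[f_0,f_1,\dots,f_n]$ of $a$ ends. Let $I_a$ be the set of the $i>0$ for which $f_i$ is defined. Promenade. Let $\mathbb{H}$ be the set of points $\eta_{x,r}$ ($x\in\hat K$, $r\in\mathbb{R}$) of type II and III of the Berkovich projective line over $\hat K$, where $\eta_{x,r}=\eta_{x',r'}$ if and only if $r=r'$ and $\nu(x-x')\ge r$. The group $\mathrm{GL}_2(\hat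 K)$, hence also $\Gamma=\mathrm{SL}_2(\bar A)$, acts on $\mathbb{H}$ by Moebius transformations. Let $\pi:\mathbb{H}\to\Gamma\backslash\mathbb{H}$ be the projection and let $\mathscr{R}_\infty=\{\eta_{0,r}: r\le 0\}$ be the modular ray. Then $\pi$ restricts to a bijection $\mathscr{R}_\infty\to\Gamma\backslash\mathbb{H}$, so that for every $y\in\mathbb{H}$ there is a unique real number $\pi_0(y)\ge 0$ with $\pi(y)=\pi(\eta_{0,-\pi_0(y)})$. For $a\in\hat K$ let $w_a:\mathbb{R}\to\mathbb{R}_{\ge0}$, $w_a(t)=\pi_0(\eta_{a,t})$, be the promenade of $a$, i.e. the image of the geodesic $t\mapsto\eta_{a,t}$ from $\infty$ to $a$. For every $a\in\hat K$: 1. The successive values of $w_a$ at its local maxima are the degrees $\deg(f_i)$, $i>0$: the set of points where $w_a$ has a local maximum is $\{\tau_i: i\in I_a\}$, where $\tau_i<\tau_j$ whenever $i<j$ in $I_a$, and $w_a(\tau_i)=\deg(f_i)$ for every $i\in I_a$. 2. The promenade proceeds to $\infty$ after finitely many bounces (i.e. $w_a(t)=0$ for only finitely many $t$, and $w_a(t)\to\infty$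 as $t\to\infty$) if and only if the continued fraction of $a$ ends, and this holds if and only if $a\in\tilde k$. -/

import Mathlib

open Filter Topology
open scoped Classical

noncomputable section

namespace PuiseuxCF

/-! ### The Puiseux field, its valuation and its completion

A Hahn series with exponents in `ℚ` is read in the variable `t⁻¹`: the coefficient at `q` is the
coefficient of `t ^ (-q)`, so that `HahnSeries.addVal` (the smallest exponent) is `ν`. -/

/-- The embedding `E((t⁻¹)) → {Hahn series in t⁻¹}`, `t⁻¹ ↦ t^(-1/n)`. -/
def rootEmb (E : Type*) [Field E] (n : ℕ+) : HahnSeries ℤ E →+* HahnSeries ℚ E :=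
  HahnSeries.embDomainRingHom
    ((AddMonoidHom.mulRight ((n : ℚ)⁻¹)).comp (Int.castAddHom ℚ))
    (fun a b h => by simpa using h)
    (fun a b => by
      have hn : (0 : ℚ) < (n : ℚ)⁻¹ := by positivity
      simp only [AddMonoidHom.coe_comp, Function.comp_apply, Int.coe_castAddHom,
        AddMonoidHom.coe_mulRight]
      rw [mul_le_mul_iff_left₀ hn, Int.cast_le])

theorem rootEmb_coeff (E : Type*) [Field E] (n : ℕ+) (x : HahnSeries ℤ E) (k : ℤ) :
    (rootEmb E n x).coeff ((k : ℚ) * (n : ℚ)⁻¹) = x.coeff k :=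
  HahnSeries.embDomain_coeff (a := k)

theorem rootEmb_support (E : Type*) [Field E] (n : ℕ+) (x : HahnSeries ℤ E) (q : ℚ)
    (hq : (rootEmb E n x).coeff q ≠ 0) : ∃ k : ℤ, q = (k : ℚ) * (n : ℚ)⁻¹ ∧ x.coeff k ≠ 0 := by
  by_contra! h
  by_cases hk : ∃ k : ℤ, q = (k : ℚ) * (n : ℚ)⁻¹
  · obtain ⟨k, rfl⟩ := hk
    exact hq (by rw [rootEmb_coeff]; exact h k rfl)
  · apply hq
    refine HahnSeries.embDomain_of_notMem_range ?_
    rintro ⟨k, hk'⟩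
    exact hk ⟨k, hk'.symm⟩

/-- `K_n = E((t^(-1/n)))`. -/
def laurentRoot (E : Type*) [Field E] (n : ℕ+) : Subfield (HahnSeries ℚ E) :=
  (rootEmb E n).fieldRange

theorem mem_laurentRoot (E : Type*) [Field E] (n : ℕ+) (x : HahnSeries ℚ E) :
    x ∈ laurentRoot E n ↔ ∀ q, x.coeff q ≠ 0 → ∃ k : ℤ, q = (k : ℚ) * (n : ℚ)⁻¹ := by
  constructor
  · rintro ⟨y, rfl⟩ q hq
    obtain ⟨k, hk, -⟩ := rootEmb_support E n y q hq
    exact ⟨k, hk⟩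
  · intro h
    have hn : (0 : ℚ) < (n : ℚ)⁻¹ := by positivity
    have hmono : StrictMono fun k : ℤ => (k : ℚ) * (n : ℚ)⁻¹ := fun a b hab => by
      have : (a : ℚ) < b := by exact_mod_cast hab
      exact mul_lt_mul_of_pos_right this hn
    refine ⟨⟨fun k => x.coeff ((k : ℚ) * (n : ℚ)⁻¹), ?_⟩, ?_⟩
    · have hw := x.isWF_support
      apply Set.IsWF.isPWO
      rw [Set.isWF_iff_no_descending_seq] at hw ⊢
      intro f hf hfs
      exact hw (fun i => (f i : ℚ) * (n : ℚ)⁻¹) (fun a b hab => hmono (hf hab)) hfs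
    · ext q
      by_cases hk : ∃ k : ℤ, q = (k : ℚ) * (n : ℚ)⁻¹
      · obtain ⟨k, rfl⟩ := hk
        rw [rootEmb_coeff]
      · have h1 : x.coeff q = 0 := by
          by_contra h1
          exact hk (h q h1)
        rw [h1]
        by_contra h2
        obtain ⟨k, hk', -⟩ := rootEmb_support E n _ q h2
        exact hk ⟨k, hk'⟩

theorem laurentRoot_mono (E : Type*) [Field E] (n m : ℕ+) :
    laurentRoot E n ≤ laurentRoot E (n * m) := by
  intro x hx
  rw [mem_laurentRoot] at hx ⊢
  intro q hq
  obtain ⟨k, rfl⟩ := hx q hq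
  refine ⟨k * m, ?_⟩
  have h1 : (n : ℚ) ≠ 0 := by positivity
  have h2 : (m : ℚ) ≠ 0 := by positivity
  push_cast
  field_simp

/-- The Puiseux field `K̃ = ⋃ₙ E((t^(-1/n)))`. -/
def puiseuxField (E : Type*) [Field E] : Subfield (HahnSeries ℚ E) where
  carrier := {x | ∃ n : ℕ+, x ∈ laurentRoot E n}
  zero_mem' := ⟨1, zero_mem _⟩
  one_mem' := ⟨1, one_mem _⟩
  neg_mem' := fun ⟨n, hn⟩ => ⟨n, neg_mem hn⟩
  inv_mem' := fun _ ⟨n, hn⟩ => ⟨n, inv_mem hn⟩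
  add_mem' := fun ⟨n, hn⟩ ⟨m, hm⟩ =>
    ⟨n * m, add_mem (laurentRoot_mono E n m hn) (mul_comm m n ▸ laurentRoot_mono E m n hm)⟩
  mul_mem' := fun ⟨n, hn⟩ ⟨m, hm⟩ =>
    ⟨n * m, mul_mem (laurentRoot_mono E n m hn) (mul_comm m n ▸ laurentRoot_mono E m n hm)⟩

/-- The Puiseux field as a type. -/
abbrev Puiseux (E : Type*) [Field E] : Type _ := puiseuxField E

/-- The valuation `ν` on the Puiseux field, with `ν(t^r) = -r`. -/
def puiseuxVal (E : Type*) [Field E] : AddValuation (Puiseux E) (WithTop ℚ) :=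
  (HahnSeries.addVal ℚ E).comap (puiseuxField E).subtype

instance puiseuxValued (E : Type*) [Field E] :
    Valued (Puiseux E) (Multiplicative (WithTop ℚ)ᵒᵈ) :=
  Valued.mk' (AddValuation.toValuation (puiseuxVal E))

/-- The completion `K̂` of the Puiseux field. -/
abbrev Khat (E : Type*) [Field E] : Type _ := UniformSpace.Completion (Puiseux E)

/-- The inclusion `K̃ → K̂`. -/
def toKhat (E : Type*) [Field E] : Puiseux E →+* Khat E := UniformSpace.Completion.coeRingHom

/-- The extension of `ν` to `K̂`, with values in `ℚ ∪ {∞}`. -/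
def khatVal (E : Type*) [Field E] : AddValuation (Khat E) (WithTop ℚ) :=
  AddValuation.ofValuation Valued.extensionValuation

/-- The inclusion `ℚ ∪ {∞} → [-∞, ∞]`. -/
def extReal : WithTop ℚ → EReal
  | ⊤ => ⊤
  | (q : ℚ) => ((q : ℝ) : EReal)

/-- `ν : K̂ → [-∞, ∞]`, with `ν 0 = ∞`. -/
def nu {E : Type*} [Field E] (x : Khat E) : EReal := extReal (khatVal E x)

/-- `deg = -ν`, with `deg 0 = -∞`. -/
def deg {E : Type*} [Field E] (x : Khat E) : EReal := -nu x

/-! ### Puiseux polynomials -/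

/-- Finite sums `∑ aᵢ t^(rᵢ)` with `aᵢ ∈ E` and `rᵢ ∈ ℚ`, `rᵢ ≥ 0`, as Hahn series in `t⁻¹`. -/
def puiseuxPolyHahn (E : Type*) [Field E] : Subring (HahnSeries ℚ E) where
  carrier := {x | x.support.Finite ∧ ∀ q ∈ x.support, q ≤ 0}
  zero_mem' := by simp
  one_mem' := by
    have h : (1 : HahnSeries ℚ E).support = {0} := HahnSeries.support_one
    simp [h]
  neg_mem' := by
    rintro x ⟨h1, h2⟩
    have h : (-x).support = x.support := HahnSeries.support_neg
    exact ⟨h ▸ h1, h ▸ h2⟩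
  add_mem' := by
    rintro x y ⟨h1, h2⟩ ⟨h3, h4⟩
    refine ⟨(h1.union h3).subset (HahnSeries.support_add_subset x y), fun q hq => ?_⟩
    rcases HahnSeries.support_add_subset x y hq with h | h
    · exact h2 q h
    · exact h4 q h
  mul_mem' := by
    rintro x y ⟨h1, h2⟩ ⟨h3, h4⟩
    refine ⟨(h1.add h3).subset HahnSeries.support_mul_subset, fun q hq => ?_⟩
    obtain ⟨a, ha, b, hb, rfl⟩ := Set.mem_add.1 (HahnSeries.support_mul_subset hq)
    exact add_nonpos (h2 a ha) (h4 b hb)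

theorem puiseuxPolyHahn_le (E : Type*) [Field E] (x : HahnSeries ℚ E)
    (hx : x ∈ puiseuxPolyHahn E) : x ∈ puiseuxField E := by
  have hfin : x.support.Finite := hx.1
  refine ⟨∏ q ∈ hfin.toFinset, q.pnatDen, (mem_laurentRoot E _ x).2 fun q hq => ?_⟩
  have hdvd : q.pnatDen ∣ ∏ q ∈ hfin.toFinset, q.pnatDen :=
    Finset.dvd_prod_of_mem Rat.pnatDen (hfin.mem_toFinset.2 hq)
  obtain ⟨m, hm⟩ := hdvd
  have h1 : ((m : ℕ) : ℚ) ≠ 0 := by exact_mod_cast m.ne_zero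
  have h2 : (q.den : ℚ) ≠ 0 := by exact_mod_cast q.den_ne_zero
  have h4 := Rat.num_div_den q
  refine ⟨q.num * (m : ℕ), ?_⟩
  rw [hm, PNat.mul_coe, Rat.coe_pnatDen]
  push_cast
  conv_lhs => rw [← h4]
  field_simp

/-- The ring `Ā` of Puiseux polynomials, as a subring of `K̂`. -/
def Abar (E : Type*) [Field E] : Subring (Khat E) :=
  ((puiseuxPolyHahn E).comap (puiseuxField E).subtype).map (toKhat E)

/-- `k̃ = Quot(Ā)`, the field of fractions of `Ā` inside `K̂`. -/
def ktilde (E : Type*) [Field E] : Subfield (Khat E) := Subfield.closure (Abar E : Set (Khat E))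

/-! ### The continued fraction of an element of `K̂` -/

theorem khatVal_coe {E : Type*} [Field E] (x : Puiseux E) :
    khatVal E (toKhat E x) = (x : HahnSeries ℚ E).orderTop :=
  Valued.extensionValuation_apply_coe x

theorem extReal_le_iff (x y : WithTop ℚ) : extReal x ≤ extReal y ↔ x ≤ y := by
  induction x using WithTop.recTopCoe <;> induction y using WithTop.recTopCoe <;>
    simp [extReal]

theorem nu_pos_iff {E : Type*} [Field E] (x : Khat E) : 0 < nu x ↔ 0 < khatVal E x := by
  have h : (0 : EReal) = extReal 0 := by simp [extReal]
  rw [nu, h, ← not_le, ← not_le, extReal_le_iff]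

theorem exists_puiseux_near {E : Type*} [Field E] (z : Khat E) :
    ∃ y : Puiseux E, 0 < khatVal E (z - toKhat E y) := by
  have h : IsOpen {x : Khat E | (Valued.v : Valuation (Khat E) _).restrict x < 1} :=
    Valued.isOpen_ball _ _
  have h2 : IsOpen {x : Khat E | (Valued.v : Valuation (Khat E) _).restrict (z - x) < 1} :=
    h.preimage (continuous_const.sub continuous_id)
  obtain ⟨y, hy⟩ := UniformSpace.Completion.denseRange_coe.exists_mem_open h2
    ⟨z, by simp⟩
  refine ⟨y, ?_⟩
  have hy' : (Valued.v : Valuation (Khat E) _) (z - (y : Khat E)) < 1 := by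
    simpa [Valuation.restrict_lt_one_iff] using hy
  exact hy'

theorem Abar_eq_zero {E : Type*} [Field E] {f : Khat E} (hf : f ∈ Abar E)
    (hpos : 0 < khatVal E f) : f = 0 := by
  obtain ⟨x, hx, rfl⟩ := hf
  have hx' : (x : HahnSeries ℚ E) ∈ puiseuxPolyHahn E := hx
  rw [khatVal_coe] at hpos
  by_contra h
  have hne : (x : HahnSeries ℚ E) ≠ 0 := by
    intro h0
    apply h
    rw [Subtype.ext (a1 := x) (a2 := 0) h0, map_zero]
  rw [← HahnSeries.order_eq_orderTop_of_ne_zero hne] at hpos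
  have h1 := hx'.2 _ (mt HahnSeries.coeff_order_eq_zero.1 hne)
  have h2 : 0 < (x : HahnSeries ℚ E).order := by exact_mod_cast hpos
  exact absurd h2 (not_lt.2 h1)

theorem exists_polyPart {E : Type*} [Field E] (z : Khat E) :
    ∃! f : Khat E, f ∈ Abar E ∧ 0 < nu (z - f) := by
  simp only [nu_pos_iff]
  obtain ⟨y, hy⟩ := exists_puiseux_near z
  obtain ⟨n, g, hg⟩ := y.2
  have hn : (0 : ℚ) < ((n : ℕ) : ℚ)⁻¹ := by positivity
  have hf : rootEmb E n (HahnSeries.truncLT 1 g) ∈ puiseuxPolyHahn E := by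
    have hsub : (rootEmb E n (HahnSeries.truncLT 1 g)).support ⊆
        (fun k : ℤ => (k : ℚ) * ((n : ℕ) : ℚ)⁻¹) '' Set.Icc g.order 0 := by
      intro q hq
      obtain ⟨k, rfl, hk⟩ := rootEmb_support E n _ q hq
      have hk1 : k < 1 := by
        by_contra h
        exact hk (HahnSeries.coeff_truncLT_of_le (not_lt.1 h) g)
      rw [HahnSeries.coeff_truncLT_of_lt hk1] at hk
      exact ⟨k, ⟨HahnSeries.order_le_of_coeff_ne_zero hk, by omega⟩, rfl⟩
    refine ⟨((Set.finite_Icc _ _).image _).subset hsub, fun q hq => ?_⟩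
    obtain ⟨k, hk, rfl⟩ := hsub hq
    have : (k : ℚ) ≤ 0 := by exact_mod_cast hk.2
    exact mul_nonpos_of_nonpos_of_nonneg this hn.le
  have hpos : 0 < khatVal E (z - toKhat E ⟨_, puiseuxPolyHahn_le E _ hf⟩) := by
    have h1 : 0 < khatVal E (toKhat E y - toKhat E ⟨_, puiseuxPolyHahn_le E _ hf⟩) := by
      rw [← map_sub, khatVal_coe]
      apply lt_of_not_ge
      intro hle
      have hlt : ∃ q : ℚ, q ≤ 0 ∧
          ((y : HahnSeries ℚ E) - rootEmb E n (HahnSeries.truncLT 1 g)).coeff q ≠ 0 := by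
        have hne : ((y : HahnSeries ℚ E) - rootEmb E n (HahnSeries.truncLT 1 g)) ≠ 0 := by
          intro h0
          have h0' : ((y - ⟨_, puiseuxPolyHahn_le E _ hf⟩ : Puiseux E) : HahnSeries ℚ E) = 0 := h0
          rw [h0'] at hle
          simp at hle
        refine ⟨_, ?_, mt HahnSeries.coeff_order_eq_zero.1 hne⟩
        have hle' : ((y : HahnSeries ℚ E) -
          rootEmb E n (HahnSeries.truncLT 1 g)).orderTop ≤ 0 := hle
        rw [← HahnSeries.order_eq_orderTop_of_ne_zero hne] at hle'
        exact_mod_cast hle'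
      obtain ⟨q, hq0, hq⟩ := hlt
      rw [← hg, ← map_sub] at hq
      obtain ⟨k, rfl, hk⟩ := rootEmb_support E n _ q hq
      have hk1 : k < 1 := by
        by_contra h
        have h' : (1 : ℚ) ≤ k := by exact_mod_cast not_lt.1 h
        have : 0 < (k : ℚ) * ((n : ℕ) : ℚ)⁻¹ := by positivity
        linarith
      apply hk
      rw [HahnSeries.coeff_sub, HahnSeries.coeff_truncLT_of_lt hk1, sub_self]
    have h2 := (khatVal E).map_add (z - toKhat E y)
      (toKhat E y - toKhat E ⟨_, puiseuxPolyHahn_le E _ hf⟩)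
    rw [sub_add_sub_cancel] at h2
    exact lt_of_lt_of_le (lt_min hy h1) h2
  refine ⟨toKhat E ⟨_, puiseuxPolyHahn_le E _ hf⟩, ⟨⟨_, hf, rfl⟩, hpos⟩, ?_⟩
  · rintro f' ⟨hf', hpos'⟩
    have h1 : 0 < khatVal E (f' - toKhat E ⟨_, puiseuxPolyHahn_le E _ hf⟩) := by
      have h3 := (khatVal E).map_add (f' - z) (z - toKhat E ⟨_, puiseuxPolyHahn_le E _ hf⟩)
      rw [sub_add_sub_cancel, (khatVal E).map_sub_swap] at h3
      exact lt_of_lt_of_le (lt_min hpos' hpos) h3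
    exact sub_eq_zero.1 (Abar_eq_zero (sub_mem hf' ⟨_, hf, rfl⟩) h1)

/-- The unique `f ∈ Ā` with `ν(z - f) > 0`. -/
def polyPart {E : Type*} [Field E] (z : Khat E) : Khat E := (exists_polyPart z).choose

/-- The complete quotients `z_n` of `a`: `z_0 = a` and `z_{n+1} = 1 / (z_n - f_n)`, undefined
(`none`) from the moment when `z_n = f_n`. -/
def completeQuotient {E : Type*} [Field E] (a : Khat E) : ℕ → Option (Khat E)
  | 0 => some a
  | n + 1 => (completeQuotient a n).bind fun z =>
      if z - polyPart z = 0 then none else some (1 / (z - polyPart z))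

/-- The coefficient `f_n` of the continued fraction of `a`; `none` when it is not defined. -/
def coefficient {E : Type*} [Field E] (a : Khat E) (n : ℕ) : Option (Khat E) :=
  (completeQuotient a n).map polyPart

/-- The set of the `i > 0` for which the coefficient `f_i` is defined. -/
def indices {E : Type*} [Field E] (a : Khat E) : Set ℕ :=
  {i | 0 < i ∧ (coefficient a i).isSome}

/-- The continued fraction of `a` ends. -/
def FractionEnds {E : Type*} [Field E] (a : Khat E) : Prop := ∃ n, coefficient a n = none

/-! ### The points of type II and III and the action of `GL₂(K̂)` -/

/-- A real absolute value for `ν`. -/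
def nrm {E : Type*} [Field E] (x : Khat E) : ℝ :=
  if x = 0 then 0 else Real.exp (-(nu x).toReal)

theorem nu_eq_top_iff {E : Type*} [Field E] (x : Khat E) : nu x = ⊤ ↔ x = 0 := by
  rw [← (khatVal E).top_iff, nu]
  induction khatVal E x using WithTop.recTopCoe <;> simp [extReal]

theorem nu_ne_bot {E : Type*} [Field E] (x : Khat E) : nu x ≠ ⊥ := by
  rw [nu]
  induction khatVal E x using WithTop.recTopCoe <;> simp [extReal]

theorem nu_mul {E : Type*} [Field E] (x y : Khat E) : nu (x * y) = nu x + nu y := by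
  simp only [nu, (khatVal E).map_mul]
  induction khatVal E x using WithTop.recTopCoe <;>
    induction khatVal E y using WithTop.recTopCoe
  · rfl
  · rfl
  · rfl
  · rename_i a b
    rw [← WithTop.coe_add]
    simp [extReal]

theorem nrm_zero {E : Type*} [Field E] : nrm (0 : Khat E) = 0 := by simp [nrm]

theorem nrm_pos {E : Type*} [Field E] {x : Khat E} (hx : x ≠ 0) : 0 < nrm x := by
  rw [nrm, if_neg hx]; exact Real.exp_pos _

theorem nrm_nonneg {E : Type*} [Field E] (x : Khat E) : 0 ≤ nrm x := by
  rcases eq_or_ne x 0 with rfl | h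
  · rw [nrm_zero]
  · exact (nrm_pos h).le

theorem coe_toReal_nu {E : Type*} [Field E] {x : Khat E} (hx : x ≠ 0) :
    ((nu x).toReal : EReal) = nu x :=
  EReal.coe_toReal (mt (nu_eq_top_iff x).1 hx) (nu_ne_bot x)

theorem nrm_le_iff {E : Type*} [Field E] (x : Khat E) (r : ℝ) :
    nrm x ≤ Real.exp (-r) ↔ (r : EReal) ≤ nu x := by
  rcases eq_or_ne x 0 with rfl | h
  · simp [nrm_zero, (nu_eq_top_iff (0 : Khat E)).2 rfl, (Real.exp_pos _).le]
  · rw [nrm, if_neg h, Real.exp_le_exp, neg_le_neg_iff, ← coe_toReal_nu h, EReal.toReal_coe,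
      EReal.coe_le_coe_iff]

theorem nrm_le_nrm_iff {E : Type*} [Field E] (x y : Khat E) :
    nrm x ≤ nrm y ↔ nu y ≤ nu x := by
  rcases eq_or_ne y 0 with rfl | h
  · rw [nrm_zero, (nu_eq_top_iff (0 : Khat E)).2 rfl, top_le_iff, nu_eq_top_iff]
    refine ⟨fun h => ?_, fun h => by rw [h, nrm_zero]⟩
    by_contra hx
    exact absurd (nrm_pos hx) (not_lt.2 h)
  · nth_rw 2 [nrm]
    rw [if_neg h, nrm_le_iff, coe_toReal_nu h]

theorem nrm_mul {E : Type*} [Field E] (x y : Khat E) : nrm (x * y) = nrm x * nrm y := by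
  rcases eq_or_ne x 0 with rfl | hx
  · simp [nrm_zero]
  rcases eq_or_ne y 0 with rfl | hy
  · simp [nrm_zero]
  have h : (nu (x * y)).toReal = (nu x).toReal + (nu y).toReal := by
    rw [nu_mul, ← coe_toReal_nu hx, ← coe_toReal_nu hy]
    norm_cast
  simp only [nrm, hx, hy, mul_eq_zero, or_self, if_false]
  rw [h, ← Real.exp_add]
  congr 1
  ring

theorem nrm_add_le {E : Type*} [Field E] (x y : Khat E) :
    nrm (x + y) ≤ max (nrm x) (nrm y) := by
  have h := (khatVal E).map_add x y
  rw [le_max_iff, nrm_le_nrm_iff, nrm_le_nrm_iff]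
  simp only [nu, extReal_le_iff]
  exact min_le_iff.1 h

theorem nrm_neg {E : Type*} [Field E] (x : Khat E) : nrm (-x) = nrm x := by
  apply le_antisymm <;> rw [nrm_le_nrm_iff, nu, nu, (khatVal E).map_neg]

theorem nrm_one {E : Type*} [Field E] : nrm (1 : Khat E) = 1 := by
  have h := nrm_mul (1 : Khat E) 1
  have h2 := nrm_pos (one_ne_zero : (1 : Khat E) ≠ 0)
  rw [mul_one] at h
  nlinarith

theorem nrm_sub_comm {E : Type*} [Field E] (x y : Khat E) : nrm (x - y) = nrm (y - x) := by
  rw [← nrm_neg, neg_sub]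

/-- `max (|x|, R) = max (|y|, R)` as soon as `|x - y| ≤ R`. -/
theorem nrm_max_congr {E : Type*} [Field E] {x y : Khat E} {R : ℝ} (h : nrm (x - y) ≤ R) :
    max (nrm x) R = max (nrm y) R := by
  have h1 := nrm_add_le (x - y) y
  have h2 := nrm_add_le (y - x) x
  rw [sub_add_cancel] at h1 h2
  rw [nrm_sub_comm y x] at h2
  apply le_antisymm
  · exact max_le (h1.trans (max_le (h.trans (le_max_right _ _)) (le_max_left _ _)))
      (le_max_right _ _)
  · exact max_le (h2.trans (max_le (h.trans (le_max_right _ _)) (le_max_left _ _)))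
      (le_max_right _ _)

/-- `(a, r) ∼ (a', r')` when `r = r'` and `ν(a - a') ≥ r`. -/
instance ballSetoid (E : Type*) [Field E] : Setoid (Khat E × ℝ) where
  r p q := p.2 = q.2 ∧ (p.2 : EReal) ≤ nu (p.1 - q.1)
  iseqv := by
    simp only [← nrm_le_iff]
    refine ⟨fun p => ⟨rfl, ?_⟩, fun {p q} h => ⟨h.1.symm, ?_⟩, fun {p q s} h h' =>
      ⟨h.1.trans h'.1, ?_⟩⟩
    · rw [sub_self, nrm_zero]; exact (Real.exp_pos _).le
    · rw [nrm_sub_comm, ← h.1]; exact h.2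
    · have h3 := nrm_add_le (p.1 - q.1) (q.1 - s.1)
      rw [sub_add_sub_cancel] at h3
      exact h3.trans (max_le h.2 (h.1 ▸ h'.2))

/-- The space `ℍ` of the points of type II and III of the Berkovich projective line over `K̂`. -/
def HR (E : Type*) [Field E] : Type _ := Quotient (ballSetoid E)

/-- The point `η_{a,r}`, that is, the closed ball `{b | ν(b - a) ≥ r}`. -/
def eta {E : Type*} [Field E] (a : Khat E) (r : ℝ) : HR E := Quotient.mk (ballSetoid E) (a, r)

theorem eta_eq_iff {E : Type*} [Field E] (a a' : Khat E) (r r' : ℝ) :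
    eta a r = eta a' r' ↔ r = r' ∧ (r : EReal) ≤ nu (a - a') :=
  Quotient.eq (r := ballSetoid E)

/-- `ν(η_{a,r}) = r`. -/
def nuPoint {E : Type*} [Field E] : HR E → ℝ := Quotient.lift (fun p => p.2) fun _ _ h => h.1

/-- The image of the ball `B = {b | ν(b - x) ≥ r}` under the Moebius transformation
`z ↦ (a z + b) / (c z + d)`. If the pole is not in `B`, the image is the ball centred at the image
of `x`. If the pole is in `B`, the point is sent to the ball centred at `a / c` which is the
complement of the image of the open ball `{b | ν(b - x) > r}` around the pole. -/
def moebiusBall {E : Type*} [Field E] (g : GL (Fin 2) (Khat E)) (p : Khat E × ℝ) : HR E :=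
  if nu (g 1 0 * p.1 + g 1 1) < (p.2 : EReal) + nu (g 1 0) then
    eta ((g 0 0 * p.1 + g 0 1) / (g 1 0 * p.1 + g 1 1))
      (p.2 + (nu g.det.1).toReal - 2 * (nu (g 1 0 * p.1 + g 1 1)).toReal)
  else
    eta (g 0 0 / g 1 0) ((nu g.det.1).toReal - 2 * (nu (g 1 0)).toReal - p.2)

/-- The size on the ball `p = (x, r)` of the linear form `z ↦ u z + v`. -/
def formSize {E : Type*} [Field E] (p : Khat E × ℝ) (u v : Khat E) : ℝ :=
  max (nrm (u * p.1 + v)) (nrm u * Real.exp (-p.2))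

theorem eta_eq_of_formSize {E : Type*} [Field E] {p q : Khat E × ℝ} {κ : ℝ}
    (h : ∀ u v, formSize p u v = κ * formSize q u v) : eta p.1 p.2 = eta q.1 q.2 := by
  have h1 := h 0 1
  simp only [formSize, zero_mul, zero_add, nrm_zero, nrm_one] at h1
  rw [max_eq_left zero_le_one, mul_one] at h1
  subst h1
  simp only [one_mul, formSize] at h
  have h2 := h 1 (-p.1)
  have h3 := h 1 (-q.1)
  simp only [one_mul, nrm_one, ← sub_eq_add_neg, sub_self, nrm_zero] at h2 h3
  rw [max_eq_right (Real.exp_pos _).le] at h2 h3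
  have h4 : Real.exp (-q.2) ≤ Real.exp (-p.2) := h2 ▸ le_max_right _ _
  have h5 : Real.exp (-p.2) ≤ Real.exp (-q.2) := h3 ▸ le_max_right _ _
  have h6 : nrm (p.1 - q.1) ≤ Real.exp (-p.2) := by
    rw [nrm_sub_comm, h2]; exact le_max_left _ _
  rw [eta_eq_iff, ← nrm_le_iff]
  refine ⟨?_, h6⟩
  have := Real.exp_injective (le_antisymm h5 h4)
  linarith

theorem formSize_congr {E : Type*} [Field E] {p q : Khat E × ℝ} (h : eta p.1 p.2 = eta q.1 q.2)
    (u v : Khat E) : formSize p u v = formSize q u v := by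
  rw [eta_eq_iff, ← nrm_le_iff] at h
  rw [formSize, formSize, ← h.1]
  apply nrm_max_congr
  have : u * p.1 + v - (u * q.1 + v) = u * (p.1 - q.1) := by ring
  rw [this, nrm_mul]
  exact mul_le_mul_of_nonneg_left h.2 (nrm_nonneg _)

theorem nrm_eq_exp {E : Type*} [Field E] {x : Khat E} (hx : x ≠ 0) :
    nrm x = Real.exp (-(nu x).toReal) := by rw [nrm, if_neg hx]

theorem nrm_div {E : Type*} [Field E] (x : Khat E) {y : Khat E} (hy : y ≠ 0) :
    nrm (x / y) = nrm x / nrm y := by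
  rw [eq_div_iff (nrm_pos hy).ne', ← nrm_mul, div_mul_cancel₀ x hy]

theorem nu_lt_add_iff {E : Type*} [Field E] (x c : Khat E) (r : ℝ) :
    nu x < (r : EReal) + nu c ↔ nrm c * Real.exp (-r) < nrm x := by
  rw [← not_le, ← not_le, not_iff_not]
  rcases eq_or_ne c 0 with rfl | hc
  · rw [nrm_zero, zero_mul, (nu_eq_top_iff (0 : Khat E)).2 rfl, EReal.coe_add_top, top_le_iff,
      nu_eq_top_iff]
    refine ⟨fun h => by rw [h, nrm_zero], fun h => ?_⟩
    by_contra hx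
    exact absurd (nrm_pos hx) (not_lt.2 h)
  · rw [nrm_eq_exp hc, ← Real.exp_add, ← neg_add, nrm_le_iff, ← coe_toReal_nu hc]
    push_cast
    rw [EReal.toReal_coe, add_comm]

theorem moebiusBall_spec {E : Type*} [Field E] (g : GL (Fin 2) (Khat E)) (p : Khat E × ℝ) :
    ∃ q : Khat E × ℝ, ∃ κ : ℝ, moebiusBall g p = eta q.1 q.2 ∧ ∀ u v,
      formSize q u v = κ * formSize p (u * g 0 0 + v * g 1 0) (u * g 0 1 + v * g 1 1) := by
  obtain ⟨x, r⟩ := p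
  have hdet : g.det.1 = g 0 0 * g 1 1 - g 0 1 * g 1 0 := Matrix.det_fin_two _
  have hdet0 : g.det.1 ≠ 0 := g.det.ne_zero
  simp only [moebiusBall]
  generalize g.det.1 = D at hdet hdet0 ⊢
  generalize g 0 0 = a at hdet ⊢
  generalize g 0 1 = b at hdet ⊢
  generalize g 1 0 = c at hdet ⊢
  generalize g 1 1 = d at hdet ⊢
  have hρ := Real.exp_pos (-r)
  split_ifs with h
  · rw [nu_lt_add_iff] at h
    have he : c * x + d ≠ 0 := by
      intro h0
      rw [h0, nrm_zero] at h
      exact absurd h (not_lt.2 (mul_nonneg (nrm_nonneg _) hρ.le))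
    have hexp : Real.exp (-(r + (nu D).toReal - 2 * (nu (c * x + d)).toReal)) =
        Real.exp (-r) * nrm D / (nrm (c * x + d) * nrm (c * x + d)) := by
      rw [nrm_eq_exp hdet0, nrm_eq_exp he, ← Real.exp_add, ← Real.exp_add, ← Real.exp_sub]
      congr 1
      ring
    refine ⟨(_, _), (nrm (c * x + d))⁻¹, rfl, fun u v => ?_⟩
    simp only [formSize, hexp]
    set e := c * x + d with he'
    have hep := nrm_pos he
    set L := u * (a * x + b) + v * e with hL
    have e1 : u * ((a * x + b) / e) + v = L / e := by rw [hL]; field_simp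
    have e2 : (u * a + v * c) * x + (u * b + v * d) = L := by rw [hL, he']; ring
    have e3 : u * a + v * c = (c * L + u * D) / e := by
      rw [eq_div_iff he, hL, hdet, he']; ring
    rw [e1, e2, e3, nrm_div _ he, nrm_div _ he]
    have hρe : 0 ≤ Real.exp (-r) / nrm e := by positivity
    have hcL : nrm (c * L) * (Real.exp (-r) / nrm e) ≤ nrm L := by
      rw [nrm_mul]
      calc nrm c * nrm L * (Real.exp (-r) / nrm e)
          = nrm L * (nrm c * Real.exp (-r) / nrm e) := by ring
        _ ≤ nrm L * 1 := by
            refine mul_le_mul_of_nonneg_left ?_ (nrm_nonneg _)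
            rw [div_le_one hep]; exact h.le
        _ = nrm L := mul_one _
    have key : max (nrm L) (nrm (c * L + u * D) * (Real.exp (-r) / nrm e)) =
        max (nrm L) (nrm (u * D) * (Real.exp (-r) / nrm e)) := by
      have k1 := mul_le_mul_of_nonneg_right (nrm_add_le (c * L) (u * D)) hρe
      have k2 := mul_le_mul_of_nonneg_right (nrm_add_le (c * L + u * D) (-(c * L))) hρe
      rw [nrm_neg, add_neg_cancel_comm] at k2
      rw [max_mul_of_nonneg _ _ hρe] at k1 k2
      apply le_antisymm
      · exact max_le (le_max_left _ _)
          (k1.trans (max_le (hcL.trans (le_max_left _ _)) (le_max_right _ _)))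
      · exact max_le (le_max_left _ _)
          (k2.trans (max_le (le_max_right _ _) (hcL.trans (le_max_left _ _))))
    have e4 : nrm (c * L + u * D) / nrm e * Real.exp (-r) =
        nrm (c * L + u * D) * (Real.exp (-r) / nrm e) := by ring
    rw [e4, key, mul_max_of_nonneg _ _ (inv_nonneg.2 hep.le), nrm_mul u D]
    congr 1
    · ring
    · field_simp
  · rw [nu_lt_add_iff, not_lt] at h
    have hc : c ≠ 0 := by
      rintro rfl
      rw [nrm_zero, zero_mul (Real.exp (-r))] at h
      have h0 : 0 * x + d = 0 := by
        by_contra h0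
        exact absurd (nrm_pos h0) (not_lt.2 h)
      apply hdet0
      rw [hdet]
      have : d = 0 := by simpa using h0
      rw [this]; ring
    have hexp : Real.exp (-((nu D).toReal - 2 * (nu c).toReal - r)) =
        nrm D / (nrm c * nrm c * Real.exp (-r)) := by
      rw [nrm_eq_exp hdet0, nrm_eq_exp hc, ← Real.exp_add, ← Real.exp_add, ← Real.exp_sub]
      congr 1
      ring
    refine ⟨(_, _), (nrm c * Real.exp (-r))⁻¹, rfl, fun u v => ?_⟩
    simp only [formSize, hexp]
    have hcp := nrm_pos hc
    set M := u * a + v * c with hM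
    have e1 : u * (a / c) + v = M / c := by rw [hM]; field_simp
    have e2 : nrm (M * x + (u * b + v * d) - (-(u * D / c))) ≤ nrm M * Real.exp (-r) := by
      have : M * x + (u * b + v * d) - (-(u * D / c)) = M * ((c * x + d) / c) := by
        rw [hM, hdet]; field_simp; ring
      rw [this, nrm_mul, nrm_div _ hc]
      refine mul_le_mul_of_nonneg_left ?_ (nrm_nonneg _)
      rw [div_le_iff₀ hcp, mul_comm (Real.exp (-r))]; exact h
    rw [nrm_max_congr e2, e1, nrm_div _ hc, nrm_neg, nrm_div _ hc, nrm_mul u D,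
      mul_max_of_nonneg _ _ (by positivity), max_comm]
    congr 1
    · field_simp
    · field_simp

theorem eta_eq_of_forms {E : Type*} [Field E] {q q' : Khat E × ℝ} {κ κ' : ℝ}
    {F : Khat E → Khat E → ℝ} (h : ∀ u v, formSize q u v = κ * F u v)
    (h' : ∀ u v, formSize q' u v = κ' * F u v) : eta q.1 q.2 = eta q'.1 q'.2 := by
  have h1 := h 0 1
  have h2 := h' 0 1
  simp only [formSize, zero_mul, zero_add, nrm_zero, nrm_one] at h1 h2
  rw [max_eq_left zero_le_one] at h1 h2
  have h3 : F 0 1 ≠ 0 := by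
    intro h0
    rw [h0, mul_zero] at h1
    exact one_ne_zero h1
  have h4 : κ = κ' := mul_right_cancel₀ h3 (h1.symm.trans h2)
  refine eta_eq_of_formSize (κ := 1) fun u v => ?_
  rw [h, h', h4, one_mul]

theorem moebiusBall_congr {E : Type*} [Field E] (g : GL (Fin 2) (Khat E)) {p p' : Khat E × ℝ}
    (h : eta p.1 p.2 = eta p'.1 p'.2) : moebiusBall g p = moebiusBall g p' := by
  obtain ⟨q, κ, hq, hs⟩ := moebiusBall_spec g p
  obtain ⟨q', κ', hq', hs'⟩ := moebiusBall_spec g p'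
  rw [hq, hq']
  refine eta_eq_of_forms (κ' := κ') hs fun u v => ?_
  rw [hs', formSize_congr h]

/-- The action of `GL₂(K̂)` on `ℍ` by Moebius transformations. -/
instance moebiusAction (E : Type*) [Field E] : MulAction (GL (Fin 2) (Khat E)) (HR E) where
  smul g := Quotient.lift (moebiusBall g) fun _ _ h => moebiusBall_congr g (Quotient.sound h)
  one_smul := by
    rintro ⟨p⟩
    obtain ⟨q, κ, hq, hs⟩ := moebiusBall_spec 1 p
    change moebiusBall 1 p = eta p.1 p.2
    rw [hq]
    refine eta_eq_of_formSize (κ := κ) fun u v => ?_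
    rw [hs]
    simp
  mul_smul g h := by
    rintro ⟨p⟩
    obtain ⟨q, κ, hq, hs⟩ := moebiusBall_spec (g * h) p
    obtain ⟨q₁, κ₁, hq₁, hs₁⟩ := moebiusBall_spec h p
    obtain ⟨q₂, κ₂, hq₂, hs₂⟩ := moebiusBall_spec g q₁
    have e : Quotient.lift (moebiusBall g)
        (fun _ _ h => moebiusBall_congr g (Quotient.sound h)) (moebiusBall h p) =
          moebiusBall g q₁ := by rw [hq₁]; rfl
    change moebiusBall (g * h) p = Quotient.lift (moebiusBall g) _ (moebiusBall h p)
    rw [e, hq, hq₂]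
    refine eta_eq_of_forms (κ' := κ₂ * κ₁) hs fun u v => ?_
    rw [hs₂, hs₁, mul_assoc]
    congr 2
    congr 1 <;> simp [Matrix.mul_apply, Fin.sum_univ_two] <;> ring

/-! ### The modular ray and the promenade -/

/-- `Γ = SL₂(Ā)` as a subgroup of `GL₂(K̂)`. -/
def Gam (E : Type*) [Field E] : Subgroup (GL (Fin 2) (Khat E)) :=
  (Matrix.SpecialLinearGroup.toGL.comp
    (Matrix.SpecialLinearGroup.map (Abar E).subtype) :
      Matrix.SpecialLinearGroup (Fin 2) (Abar E) →* GL (Fin 2) (Khat E)).range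

/-- The space of orbits `Γ \ ℍ`. -/
abbrev OrbitSpace (E : Type*) [Field E] : Type _ := MulAction.orbitRel.Quotient (Gam E) (HR E)

/-- The projection `π : ℍ → Γ \ ℍ`. -/
def orbitProj {E : Type*} [Field E] (y : HR E) : OrbitSpace E :=
  Quotient.mk (MulAction.orbitRel (Gam E) (HR E)) y

/-- The modular ray `{η_{0,r} | r ≤ 0}`. -/
def modularRay (E : Type*) [Field E] : Set (HR E) := {y | ∃ r : ℝ, r ≤ 0 ∧ y = eta 0 r}

instance (E : Type*) [Field E] : Nonempty (modularRay E) := ⟨⟨eta 0 0, 0, le_rfl, rfl⟩⟩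

/-- The restriction of `π` to the modular ray. -/
def rayProj (E : Type*) [Field E] (y : modularRay E) : OrbitSpace E := orbitProj y.1

/-- The map `ℍ → ℝ` which sends `y` to the `s ≥ 0` such that `η_{0,-s}` is the point of the
modular ray in the orbit of `y`. -/
def rayCoord {E : Type*} [Field E] (y : HR E) : ℝ :=
  -nuPoint (Function.invFun (rayProj E) (orbitProj y)).1

/-- The promenade of `a`: the image in the modular ray, identified with `[0, ∞)`, of the geodesic
`t ↦ η_{a,t}` from `∞` to `a`. -/
def promenade {E : Type*} [Field E] (a : Khat E) (t : ℝ) : ℝ := rayCoord (eta a t)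

/-- `w` reaches `0`, where it bounces back, only finitely many times, and tends to `∞`. -/
def EscapesAfterFinitelyManyBounces (w : ℝ → ℝ) : Prop :=
  {t | w t = 0}.Finite ∧ Tendsto w atTop atTop

end PuiseuxCF
end

/-!
Write `a = f₀ + 1 / z₁` and `d = deg z₁ = ν(a - f₀) > 0`. As long as `t ≤ d`, the ball `η_{a,t}` is
`η_{f₀,t}`, which a translation in `Γ` sends to `η_{0,t}`; the inversion `z ↦ -1 / z` exchanges
`η_{0,t}` and `η_{0,-t}`. So the promenade is `|t|` for `t ≤ d` (`promenade_eq_abs`). For `t > d`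
the inversion sends `η_{1/z₁,t}` to `η_{-z₁,t-2d}`, and since `z ↦ -z` normalises `Γ`, the
promenade of `a` at `t` is that of `z₁` at `t - 2d` (`promenade_eq_next`). The promenade of `z₁` descends from
`d` at the time `-d`, so that the promenade of `a` has a peak of height `d = deg f₁` at the time
`d`, its other peaks are the peaks of `z₁` delayed by `2d` (`isLocalMax_iff_next`), and it is `0`
at the time `2d`. Iteration gives the `n`-th peak at the time
`2 (deg f₁ + ⋯ + deg f_{n-1}) + deg f_n`.

That the modular ray meets each orbit at most once follows from the formula for the radius of the
image of a ball, because elements of `Ā` other than `0` have nonnegative degree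
(`rayProj_injective`). That it meets each orbit follows from the recursion above for the centres
`a` with a finite continued fraction. By the Euclidean algorithm these are the elements of `k̃`
(`fractionEnds_iff_mem_ktilde`; two elements of `Ā` are polynomials in the same `t ^ (1/n)`, so the
degrees of the remainders have a common denominator). Finally `k̃` is dense in `K̂`
(`exists_mem_ktilde_near`), so each ball has a centre in `k̃`.

For an infinite continued fraction it remains to see that the peaks listed above are all of them,
that is, that `∑ deg f_n` diverges. This is not automatic, as the degrees are positive rational
numbers that need not have a common denominator. But below any bound `T` the promenade of `a` is that of some
`b ∈ k̃`, which has only finitely many zeros, whereas the promenade of `a` vanishes at all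
`2 (deg f₁ + ⋯ + deg f_n)` (`exists_le_bounceTime`).
-/

noncomputable section

namespace PuiseuxCF

variable {E : Type*} [Field E]

/-! ### The valuation -/

theorem nu_zero : nu (0 : Khat E) = ⊤ := (nu_eq_top_iff 0).2 rfl

theorem nu_one : nu (1 : Khat E) = 0 := by
  simp [nu, extReal, ← WithTop.coe_zero]

theorem nu_neg (x : Khat E) : nu (-x) = nu x := by
  rw [nu, nu, (khatVal E).map_neg]

theorem le_nu_add {r : EReal} {x y : Khat E} (hx : r ≤ nu x) (hy : r ≤ nu y) :
    r ≤ nu (x + y) := by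
  have h := (khatVal E).map_add x y
  rcases min_le_iff.1 h with h | h
  · exact hx.trans ((extReal_le_iff _ _).2 h)
  · exact hy.trans ((extReal_le_iff _ _).2 h)

theorem nu_add_eq_of_lt {x y : Khat E} (h : nu x < nu y) : nu (x + y) = nu x := by
  refine le_antisymm ?_ (le_nu_add le_rfl h.le)
  by_contra! hlt
  have h1 : min (nu (x + y)) (nu y) ≤ nu (x + y + -y) :=
    le_nu_add (min_le_left _ _) (by rw [nu_neg]; exact min_le_right _ _)
  rw [add_neg_cancel_right] at h1
  exact absurd h1 (not_le.2 (lt_min hlt h))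

theorem toReal_nu_mul {x y : Khat E} (hx : x ≠ 0) (hy : y ≠ 0) :
    (nu (x * y)).toReal = (nu x).toReal + (nu y).toReal := by
  rw [nu_mul, ← coe_toReal_nu hx, ← coe_toReal_nu hy]
  norm_cast

theorem toReal_nu_inv (x : Khat E) : (nu x⁻¹).toReal = -(nu x).toReal := by
  rcases eq_or_ne x 0 with rfl | hx
  · simp [nu_zero]
  · have h := toReal_nu_mul hx (inv_ne_zero hx)
    rw [mul_inv_cancel₀ hx, nu_one] at h
    simp at h
    linarith

/-- A Puiseux polynomial other than `0` has nonnegative degree. -/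
theorem toReal_nu_nonpos_of_mem_Abar {x : Khat E} (hx : x ∈ Abar E) : (nu x).toReal ≤ 0 := by
  rcases eq_or_ne x 0 with rfl | h0
  · simp [nu_zero]
  · by_contra! h
    apply h0
    refine Abar_eq_zero hx ((nu_pos_iff x).1 ?_)
    rw [← coe_toReal_nu h0]
    exact_mod_cast h

/-! ### The orbits of `Γ` -/

theorem smul_eta (g : GL (Fin 2) (Khat E)) (x : Khat E) (r : ℝ) :
    g • eta x r = moebiusBall g (x, r) := rfl

theorem exists_mem_Gam {a b c d : Khat E} (ha : a ∈ Abar E) (hb : b ∈ Abar E) (hc : c ∈ Abar E)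
    (hd : d ∈ Abar E) (hdet : a * d - b * c = 1) :
    ∃ g ∈ Gam E, g 0 0 = a ∧ g 0 1 = b ∧ g 1 0 = c ∧ g 1 1 = d := by
  refine ⟨_, ⟨⟨!![⟨a, ha⟩, ⟨b, hb⟩; ⟨c, hc⟩, ⟨d, hd⟩], ?_⟩, rfl⟩, rfl, rfl, rfl, rfl⟩
  rw [Matrix.det_fin_two_of]
  exact Subtype.ext hdet

theorem mem_Abar_of_mem_Gam {g : GL (Fin 2) (Khat E)} (hg : g ∈ Gam E) (i j : Fin 2) :
    g i j ∈ Abar E := by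
  obtain ⟨s, rfl⟩ := hg
  exact (s i j).2

theorem det_of_mem_Gam {g : GL (Fin 2) (Khat E)} (hg : g ∈ Gam E) : g.det.1 = 1 := by
  obtain ⟨s, rfl⟩ := hg
  simp

theorem orbitProj_eq_iff {y y' : HR E} : orbitProj y = orbitProj y' ↔ ∃ g ∈ Gam E, g • y' = y := by
  rw [orbitProj, orbitProj, Quotient.eq, MulAction.orbitRel_apply]
  constructor
  · rintro ⟨g, rfl⟩
    exact ⟨g.1, g.2, rfl⟩
  · rintro ⟨g, hg, rfl⟩
    exact ⟨⟨g, hg⟩, rfl⟩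

theorem orbitProj_eta_add (x : Khat E) (r : ℝ) {f : Khat E} (hf : f ∈ Abar E) :
    orbitProj (eta (x + f) r) = orbitProj (eta x r) := by
  obtain ⟨g, hg, h1, h2, h3, h4⟩ :=
    exists_mem_Gam (one_mem _) hf (zero_mem _) (one_mem _) (by ring)
  refine orbitProj_eq_iff.2 ⟨g, hg, ?_⟩
  rw [smul_eta, moebiusBall, det_of_mem_Gam hg, h1, h2, h3, h4]
  simp [nu_zero, nu_one]

theorem orbitProj_eta_of_nu_lt {x : Khat E} {r : ℝ} (h : nu x < r) :
    orbitProj (eta x r) = orbitProj (eta (-x⁻¹) (r - 2 * (nu x).toReal)) := by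
  obtain ⟨g, hg, h1, h2, h3, h4⟩ :=
    exists_mem_Gam (zero_mem (Abar E)) (neg_mem (one_mem _)) (one_mem _) (zero_mem _) (by ring)
  refine (orbitProj_eq_iff.2 ⟨g, hg, ?_⟩).symm
  rw [smul_eta, moebiusBall, det_of_mem_Gam hg, h1, h2, h3, h4]
  simp [nu_one, h, neg_div]

theorem orbitProj_eta_zero_neg (r : ℝ) :
    orbitProj (eta (0 : Khat E) r) = orbitProj (eta 0 (-r)) := by
  obtain ⟨g, hg, h1, h2, h3, h4⟩ :=
    exists_mem_Gam (zero_mem (Abar E)) (neg_mem (one_mem _)) (one_mem _) (zero_mem _) (by ring)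
  refine (orbitProj_eq_iff.2 ⟨g, hg, ?_⟩).symm
  rw [smul_eta, moebiusBall, det_of_mem_Gam hg, h1, h2, h3, h4]
  simp [nu_zero, nu_one]

theorem eta_neg {x y : Khat E} {r s : ℝ} (h : eta x r = eta y s) : eta (-x) r = eta (-y) s := by
  rw [eta_eq_iff] at h ⊢
  refine ⟨h.1, ?_⟩
  rw [← nu_neg]
  convert h.2 using 2
  ring

/-- The map `z ↦ -z` normalises `Γ`, hence acts on the orbits. -/
theorem orbitProj_eta_neg {x y : Khat E} {r s : ℝ}
    (h : orbitProj (eta x r) = orbitProj (eta y s)) :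
    orbitProj (eta (-x) r) = orbitProj (eta (-y) s) := by
  obtain ⟨g, hg, hxy⟩ := orbitProj_eq_iff.1 h
  have hdet : g.det.1 = g 0 0 * g 1 1 - g 0 1 * g 1 0 := Matrix.det_fin_two _
  rw [det_of_mem_Gam hg] at hdet
  obtain ⟨g', hg', h1, h2, h3, h4⟩ :=
    exists_mem_Gam (mem_Abar_of_mem_Gam hg 0 0) (neg_mem (mem_Abar_of_mem_Gam hg 0 1))
      (neg_mem (mem_Abar_of_mem_Gam hg 1 0)) (mem_Abar_of_mem_Gam hg 1 1)
      (by rw [hdet]; ring)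
  refine orbitProj_eq_iff.2 ⟨g', hg', ?_⟩
  rw [smul_eta, moebiusBall, det_of_mem_Gam hg] at hxy
  rw [smul_eta, moebiusBall, det_of_mem_Gam hg', h1, h2, h3, h4]
  simp only [neg_mul_neg, nu_neg, div_neg]
  have e : g 0 0 * -y + -g 0 1 = -(g 0 0 * y + g 0 1) := by ring
  rw [e, neg_div]
  split_ifs at hxy ⊢ with hc
  · exact eta_neg hxy
  · exact eta_neg hxy

/-- An element of `Γ` moves no point of the modular ray away from the origin of the ray. -/
theorem le_of_orbitProj_eta_zero_eq {r s : ℝ} (hr : r ≤ 0)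
    (h : orbitProj (eta (0 : Khat E) s) = orbitProj (eta 0 r)) : r ≤ s := by
  obtain ⟨g, hg, hrs⟩ := orbitProj_eq_iff.1 h
  rw [smul_eta, moebiusBall, det_of_mem_Gam hg] at hrs
  have h1 := toReal_nu_nonpos_of_mem_Abar (mem_Abar_of_mem_Gam hg 1 0)
  have h2 := toReal_nu_nonpos_of_mem_Abar (mem_Abar_of_mem_Gam hg 1 1)
  simp only [mul_zero, zero_add, nu_one, EReal.toReal_zero] at hrs
  split_ifs at hrs with hc
  · have := ((eta_eq_iff _ _ _ _).1 hrs).1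
    linarith
  · have := ((eta_eq_iff _ _ _ _).1 hrs).1
    linarith

theorem rayProj_injective (E : Type*) [Field E] : Function.Injective (rayProj E) := by
  rintro ⟨_, r, hr, rfl⟩ ⟨_, s, hs, rfl⟩ h
  have h' : orbitProj (eta (0 : Khat E) r) = orbitProj (eta 0 s) := h
  refine Subtype.ext ?_
  change eta 0 r = eta 0 s
  rw [le_antisymm (le_of_orbitProj_eta_zero_eq hr h'.symm) (le_of_orbitProj_eta_zero_eq hs h')]

theorem rayCoord_eq_of_orbitProj_eq {y : HR E} {r : ℝ} (hr : r ≤ 0)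
    (h : orbitProj y = orbitProj (eta 0 r)) : rayCoord y = -r := by
  have h1 := Function.leftInverse_invFun (rayProj_injective E) ⟨eta 0 r, r, hr, rfl⟩
  rw [rayCoord, h]
  change -nuPoint (Function.invFun (rayProj E) (rayProj E ⟨eta 0 r, r, hr, rfl⟩)).1 = -r
  rw [h1]
  rfl

/-! ### The first step of the continued fraction -/

theorem polyPart_mem (z : Khat E) : polyPart z ∈ Abar E := (exists_polyPart z).choose_spec.1.1

theorem nu_sub_polyPart_pos (z : Khat E) : 0 < nu (z - polyPart z) :=
  (exists_polyPart z).choose_spec.1.2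

theorem eq_polyPart {z f : Khat E} (hf : f ∈ Abar E) (h : 0 < nu (z - f)) : f = polyPart z :=
  (exists_polyPart z).choose_spec.2 f ⟨hf, h⟩

/-- The degree `deg z₁` of the complete quotient `z₁ = 1 / (z - f₀)`, read as `0` if `z = f₀`. -/
def nextDeg (z : Khat E) : ℝ := (nu (z - polyPart z)).toReal

theorem nextDeg_pos {z : Khat E} (h : z - polyPart z ≠ 0) : 0 < nextDeg z := by
  have h1 := nu_sub_polyPart_pos z
  rw [← coe_toReal_nu h] at h1
  exact_mod_cast h1

theorem coe_nextDeg {z : Khat E} (h : z - polyPart z ≠ 0) :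
    (nextDeg z : EReal) = nu (z - polyPart z) := coe_toReal_nu h

theorem orbitProj_eta_eq_eta_zero {a : Khat E} {t : ℝ} (h : (t : EReal) ≤ nu (a - polyPart a)) :
    orbitProj (eta a t) = orbitProj (eta 0 (-|t|)) := by
  have h1 : eta a t = eta (0 + polyPart a) t := by
    rw [eta_eq_iff]
    exact ⟨rfl, by rwa [zero_add]⟩
  rw [h1, orbitProj_eta_add _ _ (polyPart_mem a)]
  rcases abs_cases t with ⟨h2, -⟩ | ⟨h2, -⟩
  · rw [h2, orbitProj_eta_zero_neg]
  · rw [h2, neg_neg]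

theorem orbitProj_eta_eq_next {a : Khat E} (ha : a - polyPart a ≠ 0) {t : ℝ}
    (h : nextDeg a < t) :
    orbitProj (eta a t) =
      orbitProj (eta (-(1 / (a - polyPart a))) (t - 2 * nextDeg a)) := by
  have h1 : orbitProj (eta a t) = orbitProj (eta (a - polyPart a) t) := by
    rw [← orbitProj_eta_add (a - polyPart a) t (polyPart_mem a), sub_add_cancel]
  rw [h1, orbitProj_eta_of_nu_lt, one_div]
  · rfl
  · rw [← coe_nextDeg ha]
    exact_mod_cast h

/-! ### The complete quotients -/

theorem completeQuotient_succ (a : Khat E) (n : ℕ) :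
    completeQuotient a (n + 1) =
      if a - polyPart a = 0 then none else completeQuotient (1 / (a - polyPart a)) n := by
  induction n with
  | zero =>
    rw [completeQuotient, completeQuotient, completeQuotient]
    rfl
  | succ n ih =>
    rw [completeQuotient, ih]
    split_ifs with h
    · rfl
    · rw [completeQuotient]

theorem completeQuotient_succ_of_ne {a : Khat E} (h : a - polyPart a ≠ 0) (n : ℕ) :
    completeQuotient a (n + 1) = completeQuotient (1 / (a - polyPart a)) n := by
  rw [completeQuotient_succ, if_neg h]

theorem fractionEnds_iff (a : Khat E) : FractionEnds a ↔ ∃ n, completeQuotient a n = none := by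
  simp [FractionEnds, coefficient]

theorem fractionEnds_next_iff {a : Khat E} (h : a - polyPart a ≠ 0) :
    FractionEnds (1 / (a - polyPart a)) ↔ FractionEnds a := by
  rw [fractionEnds_iff, fractionEnds_iff]
  constructor
  · rintro ⟨n, hn⟩
    exact ⟨n + 1, by rwa [completeQuotient_succ_of_ne h]⟩
  · rintro ⟨_ | n, hn⟩
    · simp [completeQuotient] at hn
    · exact ⟨n, by rwa [completeQuotient_succ_of_ne h] at hn⟩

theorem fractionEnds_of_eq {a : Khat E} (h : a - polyPart a = 0) : FractionEnds a :=
  (fractionEnds_iff a).2 ⟨1, by rw [completeQuotient_succ, if_pos h]⟩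

/-- Induction along the complete quotients of a continued fraction that ends. -/
@[elab_as_elim]
theorem FractionEnds.induction {P : ∀ a : Khat E, FractionEnds a → Prop}
    (h0 : ∀ a (h : a - polyPart a = 0), P a (fractionEnds_of_eq h))
    (h1 : ∀ a (h : a - polyPart a ≠ 0) (hz : FractionEnds (1 / (a - polyPart a))), P _ hz →
      P a ((fractionEnds_next_iff h).1 hz))
    {a : Khat E} (ha : FractionEnds a) : P a ha := by
  obtain ⟨n, hn⟩ := (fractionEnds_iff a).1 ha
  induction n generalizing a with
  | zero => simp [completeQuotient] at hn
  | succ n ih =>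
    by_cases h : a - polyPart a = 0
    · exact h0 a h
    · rw [completeQuotient_succ_of_ne h] at hn
      exact h1 a h _ (ih ((fractionEnds_next_iff h).2 ha) hn)

theorem exists_orbitProj_eq_of_fractionEnds {a : Khat E} (ha : FractionEnds a) (t : ℝ) :
    ∃ r ≤ 0, orbitProj (eta a t) = orbitProj (eta 0 r) := by
  induction ha using FractionEnds.induction generalizing t with
  | h0 a h =>
    refine ⟨-|t|, by simp, orbitProj_eta_eq_eta_zero ?_⟩
    rw [h, nu_zero]
    exact le_top
  | h1 a h hz ih =>
    rcases le_or_gt t (nextDeg a) with ht | ht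
    · refine ⟨-|t|, by simp, orbitProj_eta_eq_eta_zero ?_⟩
      rw [← coe_nextDeg h]
      exact_mod_cast ht
    · obtain ⟨r, hr, hr'⟩ := ih (t - 2 * nextDeg a)
      refine ⟨r, hr, ?_⟩
      rw [orbitProj_eta_eq_next h ht]
      simpa using orbitProj_eta_neg hr'

/-! ### Fractions of Puiseux polynomials -/

theorem Abar_le_ktilde {x : Khat E} (hx : x ∈ Abar E) : x ∈ ktilde E :=
  Subfield.subset_closure hx

theorem FractionEnds.mem_ktilde {a : Khat E} (ha : FractionEnds a) : a ∈ ktilde E := by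
  induction ha using FractionEnds.induction with
  | h0 a h =>
    rw [sub_eq_zero.1 h]
    exact Abar_le_ktilde (polyPart_mem a)
  | h1 a h hz ih =>
    have : a = polyPart a + (1 / (a - polyPart a))⁻¹ := by simp
    rw [this]
    exact add_mem (Abar_le_ktilde (polyPart_mem a)) (inv_mem ih)

theorem exists_div_eq_of_mem_ktilde {a : Khat E} (ha : a ∈ ktilde E) :
    ∃ p ∈ Abar E, ∃ q ∈ Abar E, q ≠ 0 ∧ p / q = a := by
  obtain ⟨p, hp, q, hq, rfl⟩ := Subfield.mem_closure_iff.1 ha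
  rw [Subring.closure_eq] at hp hq
  rcases eq_or_ne q 0 with rfl | h
  · exact ⟨0, zero_mem _, 1, one_mem _, one_ne_zero, by simp⟩
  · exact ⟨p, hp, q, hq, h, rfl⟩

/-- Each element of `K̂` is a limit of elements of `k̃`, because `Ā` contains the powers of `t`:
approximate `t ^ m * a` by its polynomial part. -/
theorem exists_mem_ktilde_near (a : Khat E) (T : ℝ) :
    ∃ b ∈ ktilde E, (T : EReal) ≤ nu (a - b) := by
  obtain ⟨m, hm⟩ := exists_nat_ge T
  have hp : HahnSeries.single (-(m : ℚ)) (1 : E) ∈ puiseuxPolyHahn E := by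
    have hs : (HahnSeries.single (-(m : ℚ)) (1 : E)).support ⊆ {-(m : ℚ)} :=
      HahnSeries.support_single_subset
    refine ⟨(Set.finite_singleton _).subset hs, fun q hq => ?_⟩
    rw [hs hq]
    simp
  obtain ⟨u, hu⟩ : ∃ u : Khat E, u = toKhat E ⟨_, puiseuxPolyHahn_le E _ hp⟩ := ⟨_, rfl⟩
  have huA : u ∈ Abar E := ⟨_, hp, hu.symm⟩
  have hnu : nu u = ((-(m : ℝ) : ℝ) : EReal) := by
    rw [hu, nu, khatVal_coe, HahnSeries.orderTop_single one_ne_zero]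
    simp [extReal]
  have hu0 : u ≠ 0 := by
    intro h
    rw [h, nu_zero] at hnu
    exact EReal.coe_ne_top _ hnu.symm
  refine ⟨polyPart (u * a) / u,
    div_mem (Abar_le_ktilde (polyPart_mem _)) (Abar_le_ktilde huA), ?_⟩
  rcases eq_or_ne (a - polyPart (u * a) / u) 0 with h | h
  · rw [h, nu_zero]
    exact le_top
  · have h1 := nu_sub_polyPart_pos (u * a)
    have h2 : u * a - polyPart (u * a) = u * (a - polyPart (u * a) / u) := by
      field_simp
    rw [h2, ← coe_toReal_nu (mul_ne_zero hu0 h), toReal_nu_mul hu0 h, hnu] at h1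
    rw [← coe_toReal_nu h]
    have h3 : 0 < -(m : ℝ) + (nu (a - polyPart (u * a) / u)).toReal := by exact_mod_cast h1
    exact_mod_cast (by linarith : T ≤ (nu (a - polyPart (u * a) / u)).toReal)

/-! ### The Euclidean algorithm -/

/-- The field `K_n = E((t^(-1/n)))` inside `K̂`. -/
def laurentRootKhat (E : Type*) [Field E] (n : ℕ+) : Subfield (Khat E) :=
  ((laurentRoot E n).comap (puiseuxField E).subtype).map (toKhat E)

theorem polyPart_mem_laurentRootKhat {n : ℕ+} {z : Khat E} (hz : z ∈ laurentRootKhat E n) :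
    polyPart z ∈ laurentRootKhat E n := by
  obtain ⟨x, ⟨g, hg⟩, rfl⟩ := hz
  have hg' : rootEmb E n g = (x : HahnSeries ℚ E) := hg
  have hn : (0 : ℚ) < ((n : ℕ) : ℚ)⁻¹ := by positivity
  -- the polynomial part drops the terms with positive exponent in `t⁻¹`
  obtain ⟨p, hp⟩ : ∃ p, p = rootEmb E n (HahnSeries.truncLT 1 g) := ⟨_, rfl⟩
  have hpA : p ∈ puiseuxPolyHahn E := by
    have hsub : p.support ⊆ (fun k : ℤ => (k : ℚ) * ((n : ℕ) : ℚ)⁻¹) '' Set.Icc g.order 0 := by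
      intro q hq
      rw [hp] at hq
      obtain ⟨k, rfl, hk⟩ := rootEmb_support E n _ q hq
      have hk1 : k < 1 := by
        by_contra h
        exact hk (HahnSeries.coeff_truncLT_of_le (not_lt.1 h) g)
      rw [HahnSeries.coeff_truncLT_of_lt hk1] at hk
      exact ⟨k, ⟨HahnSeries.order_le_of_coeff_ne_zero hk, by omega⟩, rfl⟩
    refine ⟨((Set.finite_Icc _ _).image _).subset hsub, fun q hq => ?_⟩
    obtain ⟨k, hk, rfl⟩ := hsub hq
    have : (k : ℚ) ≤ 0 := by exact_mod_cast hk.2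
    exact mul_nonpos_of_nonpos_of_nonneg this hn.le
  obtain ⟨f, hf⟩ : ∃ f : Puiseux E, (f : HahnSeries ℚ E) = p :=
    ⟨⟨_, puiseuxPolyHahn_le E _ hpA⟩, rfl⟩
  have hfA : toKhat E f ∈ Abar E := ⟨f, by rw [← hf] at hpA; exact hpA, rfl⟩
  have hpos : 0 < nu (toKhat E x - toKhat E f) := by
    rw [nu_pos_iff, ← map_sub, khatVal_coe]
    have hsub : ((x - f : Puiseux E) : HahnSeries ℚ E) =
        rootEmb E n (g - HahnSeries.truncLT 1 g) := by
      rw [map_sub, hg', ← hp, ← hf]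
      rfl
    rw [hsub]
    by_contra! hle
    have hne : rootEmb E n (g - HahnSeries.truncLT 1 g) ≠ 0 := by
      intro h0
      rw [h0] at hle
      simp at hle
    rw [← HahnSeries.order_eq_orderTop_of_ne_zero hne] at hle
    obtain ⟨k, hk, hk'⟩ := rootEmb_support E n _ _ (mt HahnSeries.coeff_order_eq_zero.1 hne)
    rw [hk] at hle
    have hle' : (k : ℚ) * ((n : ℕ) : ℚ)⁻¹ ≤ 0 := by exact_mod_cast hle
    have hk1 : k < 1 := by
      by_contra! h
      have h' : (1 : ℚ) ≤ k := by exact_mod_cast h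
      have : 0 < (k : ℚ) * ((n : ℕ) : ℚ)⁻¹ := by positivity
      linarith
    apply hk'
    rw [HahnSeries.coeff_sub, HahnSeries.coeff_truncLT_of_lt hk1, sub_self]
  rw [← eq_polyPart hfA hpos]
  refine ⟨f, ?_, rfl⟩
  change (f : HahnSeries ℚ E) ∈ laurentRoot E n
  rw [hf, hp]
  exact ⟨_, rfl⟩

theorem exists_mem_laurentRootKhat {p : Khat E} (hp : p ∈ Abar E) :
    ∃ n, p ∈ laurentRootKhat E n := by
  obtain ⟨x, -, rfl⟩ := hp
  obtain ⟨n, hn⟩ := x.2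
  exact ⟨n, x, hn, rfl⟩

theorem laurentRootKhat_mono (n m : ℕ+) : laurentRootKhat E n ≤ laurentRootKhat E (n * m) := by
  rintro _ ⟨x, hx, rfl⟩
  exact ⟨x, laurentRoot_mono E n m hx, rfl⟩

/-- The degree of a polynomial in `t ^ (1 / n)` is a natural number divided by `n`. -/
theorem exists_nat_toReal_nu {n : ℕ+} {q : Khat E} (hq : q ∈ Abar E)
    (hqn : q ∈ laurentRootKhat E n) (h0 : q ≠ 0) :
    ∃ k : ℕ, (nu q).toReal * (n : ℕ) = -(k : ℝ) := by
  have hle := toReal_nu_nonpos_of_mem_Abar hq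
  obtain ⟨x, hx, rfl⟩ := hqn
  have hne : (x : HahnSeries ℚ E) ≠ 0 := by
    intro h
    apply h0
    rw [Subtype.ext (a1 := x) (a2 := 0) h, map_zero]
  obtain ⟨k, hk⟩ := (mem_laurentRoot E n x).1 hx _ (mt HahnSeries.coeff_order_eq_zero.1 hne)
  have hnu : (nu (toKhat E x)).toReal = ((k : ℝ) * ((n : ℕ) : ℝ)⁻¹) := by
    rw [nu, khatVal_coe, ← HahnSeries.order_eq_orderTop_of_ne_zero hne, hk]
    change ((((k : ℚ) * ((n : ℕ) : ℚ)⁻¹ : ℚ) : ℝ) : EReal).toReal = _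
    rw [EReal.toReal_coe]
    push_cast
    rfl
  have hn : (0 : ℝ) < ((n : ℕ) : ℝ) := by exact_mod_cast n.pos
  have hk2 : (nu (toKhat E x)).toReal * (n : ℕ) = k := by
    rw [hnu]
    field_simp
  have hk0 : (k : ℝ) ≤ 0 := by
    rw [← hk2]
    exact mul_nonpos_of_nonpos_of_nonneg hle hn.le
  have hk1 : k ≤ 0 := by exact_mod_cast hk0
  refine ⟨k.natAbs, ?_⟩
  rw [hk2]
  have : (k.natAbs : ℤ) = -k := by omega
  have h3 : ((k.natAbs : ℤ) : ℝ) = ((-k : ℤ) : ℝ) := by rw [this]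
  push_cast at h3
  simp only [Nat.cast_natAbs, Int.cast_abs]
  linarith

theorem fractionEnds_div {n : ℕ+} (k : ℕ) {p q : Khat E} (hp : p ∈ Abar E)
    (hpn : p ∈ laurentRootKhat E n) (hq : q ∈ Abar E) (hqn : q ∈ laurentRootKhat E n)
    (h0 : q ≠ 0) (hk : (nu q).toReal * (n : ℕ) = -(k : ℝ)) : FractionEnds (p / q) := by
  induction k using Nat.strong_induction_on generalizing p q with
  | _ k ih =>
  by_cases h : p / q - polyPart (p / q) = 0
  · exact fractionEnds_of_eq h
  rw [← fractionEnds_next_iff h]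
  -- the next complete quotient is the divisor over the remainder
  obtain ⟨r, hr⟩ : ∃ r, r = p - polyPart (p / q) * q := ⟨_, rfl⟩
  have hrq : r = q * (p / q - polyPart (p / q)) := by
    rw [hr]
    field_simp
  have hr0 : r ≠ 0 := hrq ▸ mul_ne_zero h0 h
  have hnext : 1 / (p / q - polyPart (p / q)) = q / r := by
    rw [hrq]
    field_simp
  have hrA : r ∈ Abar E := hr ▸ sub_mem hp (mul_mem (polyPart_mem _) hq)
  have hrn : r ∈ laurentRootKhat E n :=
    hr ▸ sub_mem hpn (mul_mem (polyPart_mem_laurentRootKhat (div_mem hpn hqn)) hqn)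
  obtain ⟨l, hl⟩ := exists_nat_toReal_nu hrA hrn hr0
  rw [hnext]
  refine ih l ?_ hq hqn hrA hrn hr0 hl
  have h1 : (nu r).toReal = (nu q).toReal + nextDeg (p / q) := by
    rw [hrq, toReal_nu_mul h0 h, nextDeg]
  have h2 := nextDeg_pos h
  have hn : (0 : ℝ) < ((n : ℕ) : ℝ) := by exact_mod_cast n.pos
  have h3 : (l : ℝ) < k := by
    rw [h1] at hl
    nlinarith [mul_pos h2 hn]
  exact_mod_cast h3

theorem fractionEnds_iff_mem_ktilde (a : Khat E) : FractionEnds a ↔ a ∈ ktilde E := by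
  refine ⟨FractionEnds.mem_ktilde, fun ha => ?_⟩
  obtain ⟨p, hp, q, hq, h0, rfl⟩ := exists_div_eq_of_mem_ktilde ha
  obtain ⟨n, hn⟩ := exists_mem_laurentRootKhat hp
  obtain ⟨m, hm⟩ := exists_mem_laurentRootKhat hq
  have hm' : q ∈ laurentRootKhat E (n * m) := mul_comm m n ▸ laurentRootKhat_mono m n hm
  obtain ⟨k, hk⟩ := exists_nat_toReal_nu hq hm' h0
  exact fractionEnds_div k hp (laurentRootKhat_mono n m hn) hq hm' h0 hk

/-! ### The promenade -/

theorem exists_orbitProj_eq (a : Khat E) (t : ℝ) :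
    ∃ r ≤ 0, orbitProj (eta a t) = orbitProj (eta 0 r) := by
  obtain ⟨b, hb, hab⟩ := exists_mem_ktilde_near a t
  rw [(eta_eq_iff a b t t).2 ⟨rfl, hab⟩]
  exact exists_orbitProj_eq_of_fractionEnds ((fractionEnds_iff_mem_ktilde b).2 hb) t

theorem rayProj_bijective (E : Type*) [Field E] : Function.Bijective (rayProj E) := by
  refine ⟨rayProj_injective E, ?_⟩
  rintro ⟨⟨x, t⟩⟩
  obtain ⟨r, hr, h⟩ := exists_orbitProj_eq x t
  exact ⟨⟨eta 0 r, r, hr, rfl⟩, h.symm⟩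

theorem promenade_neg (a : Khat E) (t : ℝ) : promenade (-a) t = promenade a t := by
  obtain ⟨r, hr, h⟩ := exists_orbitProj_eq a t
  have h' := orbitProj_eta_neg h
  rw [neg_zero] at h'
  rw [promenade, promenade, rayCoord_eq_of_orbitProj_eq hr h, rayCoord_eq_of_orbitProj_eq hr h']

theorem promenade_congr {a b : Khat E} {t : ℝ} (h : (t : EReal) ≤ nu (a - b)) :
    promenade a t = promenade b t := by
  rw [promenade, (eta_eq_iff a b t t).2 ⟨rfl, h⟩, promenade]

theorem promenade_eq_abs {a : Khat E} {t : ℝ} (h : (t : EReal) ≤ nu (a - polyPart a)) :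
    promenade a t = |t| := by
  rw [promenade, rayCoord_eq_of_orbitProj_eq (by simp) (orbitProj_eta_eq_eta_zero h), neg_neg]

theorem promenade_eq_abs_of_eq {a : Khat E} (h : a - polyPart a = 0) (t : ℝ) :
    promenade a t = |t| :=
  promenade_eq_abs (by rw [h, nu_zero]; exact le_top)

theorem promenade_eq_abs_of_le {a : Khat E} (h : a - polyPart a ≠ 0) {t : ℝ}
    (ht : t ≤ nextDeg a) : promenade a t = |t| :=
  promenade_eq_abs (by rw [← coe_nextDeg h]; exact_mod_cast ht)

/-- The promenade comes straight down the modular ray to `0`, and bounces back there. -/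
theorem exists_pos_promenade_eq_abs (a : Khat E) : ∃ ε > 0, ∀ t ≤ ε, promenade a t = |t| := by
  by_cases h : a - polyPart a = 0
  · exact ⟨1, one_pos, fun t _ => promenade_eq_abs_of_eq h t⟩
  · exact ⟨_, nextDeg_pos h, fun t ht => promenade_eq_abs_of_le h ht⟩

theorem nu_next {a : Khat E} : (nu (1 / (a - polyPart a))).toReal = -nextDeg a := by
  rw [one_div, toReal_nu_inv, nextDeg]

theorem nu_polyPart_eq {z : Khat E} (h : nu z < 0) : nu (polyPart z) = nu z := by
  have h1 := nu_sub_polyPart_pos z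
  have h2 : polyPart z = z + -(z - polyPart z) := by ring
  rw [h2]
  exact nu_add_eq_of_lt (by rw [nu_neg]; exact h.trans h1)

theorem nu_next_lt_zero {a : Khat E} (h : a - polyPart a ≠ 0) :
    nu (1 / (a - polyPart a)) < 0 := by
  have h1 := nextDeg_pos h
  rw [← coe_toReal_nu (one_div_ne_zero h), nu_next]
  exact_mod_cast (by linarith : -nextDeg a < 0)

theorem deg_polyPart_next {a : Khat E} (h : a - polyPart a ≠ 0) :
    deg (polyPart (1 / (a - polyPart a))) = (nextDeg a : EReal) := by
  rw [deg, nu_polyPart_eq (nu_next_lt_zero h), ← coe_toReal_nu (one_div_ne_zero h), nu_next]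
  simp

/-- After its first excursion from the origin, the promenade of `a` repeats the promenade of the
complete quotient `z₁`. -/
theorem promenade_eq_next {a : Khat E} (h : a - polyPart a ≠ 0) {t : ℝ} (ht : nextDeg a ≤ t) :
    promenade a t = promenade (1 / (a - polyPart a)) (t - 2 * nextDeg a) := by
  have hd := nextDeg_pos h
  rcases ht.eq_or_lt with rfl | ht
  · have h1 : (0 : EReal) <
        nu (1 / (a - polyPart a) - polyPart (1 / (a - polyPart a))) := nu_sub_polyPart_pos _
    have h2 : ((nextDeg a - 2 * nextDeg a : ℝ) : EReal) ≤ 0 := by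
      exact_mod_cast (by linarith : nextDeg a - 2 * nextDeg a ≤ 0)
    rw [promenade_eq_abs_of_le h le_rfl, promenade_eq_abs (h2.trans h1.le)]
    rw [abs_of_pos hd, abs_of_neg (by linarith)]
    ring
  · rw [← promenade_neg (1 / _), promenade, promenade, rayCoord, rayCoord,
      orbitProj_eta_eq_next h ht]

/-! ### The peaks and the zeros of the promenade -/

/-- The degree `deg f_{n+1}`, read as `0` if `f_{n+1}` is not defined. -/
def coeffDeg (a : Khat E) (n : ℕ) : ℝ := (completeQuotient a n).elim 0 nextDeg

/-- The point `2 (deg f₁ + ⋯ + deg f_n)`, with undefined degrees read as `0`. If `f_n` is defined,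
the promenade reaches `0` there for the `n`-th time after the time `0`. -/
def bounceTime (a : Khat E) (n : ℕ) : ℝ := ∑ i ∈ Finset.range n, 2 * coeffDeg a i

/-- The point `2 (deg f₁ + ⋯ + deg f_{n-1}) + deg f_n`, the time of the `n`-th peak; it is
meaningful only if `n > 0` and `f_n` is defined. -/
def peakTime (a : Khat E) (n : ℕ) : ℝ := bounceTime a (n - 1) + coeffDeg a (n - 1)

theorem coeffDeg_zero (a : Khat E) : coeffDeg a 0 = nextDeg a := rfl

theorem coeffDeg_succ {a : Khat E} (h : a - polyPart a ≠ 0) (n : ℕ) :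
    coeffDeg a (n + 1) = coeffDeg (1 / (a - polyPart a)) n := by
  rw [coeffDeg, completeQuotient_succ_of_ne h, coeffDeg]

theorem bounceTime_zero (a : Khat E) : bounceTime a 0 = 0 := rfl

theorem bounceTime_succ {a : Khat E} (h : a - polyPart a ≠ 0) (n : ℕ) :
    bounceTime a (n + 1) = bounceTime (1 / (a - polyPart a)) n + 2 * nextDeg a := by
  rw [bounceTime, Finset.sum_range_succ', coeffDeg_zero, bounceTime]
  simp only [coeffDeg_succ h]

theorem peakTime_one (a : Khat E) : peakTime a 1 = nextDeg a := by
  simp [peakTime, bounceTime_zero, coeffDeg_zero]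

theorem peakTime_succ {a : Khat E} (h : a - polyPart a ≠ 0) (n : ℕ) :
    peakTime a (n + 2) = peakTime (1 / (a - polyPart a)) (n + 1) + 2 * nextDeg a := by
  simp only [peakTime, Nat.add_succ_sub_one, add_zero, bounceTime_succ h, coeffDeg_succ h]
  ring

theorem nextDeg_nonneg (z : Khat E) : 0 ≤ nextDeg z := by
  by_cases h : z - polyPart z = 0
  · simp [nextDeg, h, nu_zero]
  · exact (nextDeg_pos h).le

theorem coeffDeg_nonneg (a : Khat E) (n : ℕ) : 0 ≤ coeffDeg a n := by
  rw [coeffDeg]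
  cases completeQuotient a n with
  | none => exact le_rfl
  | some z => exact nextDeg_nonneg z

theorem mem_indices_succ {a : Khat E} {n : ℕ} :
    n + 1 ∈ indices a ↔ completeQuotient a (n + 1) ≠ none := by
  simp [indices, coefficient, Option.isSome_iff_ne_none]

theorem coeffDeg_pos {a : Khat E} {n : ℕ} (h : n + 1 ∈ indices a) : 0 < coeffDeg a n := by
  rw [mem_indices_succ, completeQuotient] at h
  rw [coeffDeg]
  cases hz : completeQuotient a n with
  | none => simp [hz] at h
  | some z =>
    rw [hz] at h
    refine nextDeg_pos fun h0 => h ?_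
    simp [h0]

theorem bounceTime_mono (a : Khat E) : Monotone (bounceTime a) :=
  monotone_nat_of_le_succ fun n => by
    rw [bounceTime, bounceTime, Finset.sum_range_succ]
    linarith [coeffDeg_nonneg a n]

theorem bounceTime_nonneg (a : Khat E) (n : ℕ) : 0 ≤ bounceTime a n :=
  (bounceTime_zero a).symm.le.trans (bounceTime_mono a n.zero_le)

theorem bounceTime_lt_peakTime {a : Khat E} {n : ℕ} (h : n + 1 ∈ indices a) :
    bounceTime a n < peakTime a (n + 1) := by
  rw [peakTime, Nat.add_sub_cancel]
  linarith [coeffDeg_pos h]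

theorem peakTime_lt_bounceTime {a : Khat E} {n : ℕ} (h : n + 1 ∈ indices a) :
    peakTime a (n + 1) < bounceTime a (n + 1) := by
  rw [peakTime, Nat.add_sub_cancel, bounceTime, bounceTime, Finset.sum_range_succ]
  linarith [coeffDeg_pos h]

theorem strictMonoOn_peakTime (a : Khat E) : StrictMonoOn (peakTime a) (indices a) := by
  rintro (_ | i) hi (_ | j) hj hij
  · exact absurd hi.1 (lt_irrefl _)
  · exact absurd hi.1 (lt_irrefl _)
  · exact absurd hj.1 (lt_irrefl _)
  · calc peakTime a (i + 1) < bounceTime a (i + 1) := peakTime_lt_bounceTime hi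
      _ ≤ bounceTime a j := bounceTime_mono a (by omega)
      _ < peakTime a (j + 1) := bounceTime_lt_peakTime hj

theorem zeros_finite_and_tendsto_of_fractionEnds {a : Khat E} (ha : FractionEnds a) :
    EscapesAfterFinitelyManyBounces (promenade a) := by
  induction ha using FractionEnds.induction with
  | h0 a h =>
    have hw : promenade a = fun t => |t| := funext (promenade_eq_abs_of_eq h)
    rw [hw]
    exact ⟨by simp, tendsto_abs_atTop_atTop⟩
  | h1 a h hz ih =>
    refine ⟨((ih.1.image (· + 2 * nextDeg a)).insert 0).subset fun t ht => ?_, ?_⟩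
    · rcases le_total t (nextDeg a) with h' | h'
      · left
        rwa [Set.mem_ofPred_eq, promenade_eq_abs_of_le h h', abs_eq_zero] at ht
      · right
        rw [Set.mem_ofPred_eq, promenade_eq_next h h'] at ht
        exact ⟨_, ht, sub_add_cancel _ _⟩
    · refine (ih.2.comp (tendsto_atTop_add_const_right atTop (-(2 * nextDeg a))
        tendsto_id)).congr' ?_
      filter_upwards [eventually_ge_atTop (nextDeg a)] with t ht
      rw [promenade_eq_next h ht]
      rfl

theorem promenade_bounceTime {a : Khat E} (ha : ¬ FractionEnds a) (n : ℕ) :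
    promenade a (bounceTime a n) = 0 := by
  induction n generalizing a with
  | zero =>
    obtain ⟨ε, hε, h⟩ := exists_pos_promenade_eq_abs a
    rw [bounceTime_zero, h 0 hε.le, abs_zero]
  | succ n ih =>
    have h : a - polyPart a ≠ 0 := fun h => ha (fractionEnds_of_eq h)
    have hb := bounceTime_nonneg (1 / (a - polyPart a)) n
    rw [promenade_eq_next h (by rw [bounceTime_succ h]; linarith [nextDeg_pos h]),
      bounceTime_succ h, add_sub_cancel_right]
    exact ih (mt (fractionEnds_next_iff h).1 ha)

theorem mem_indices_of_not_fractionEnds {a : Khat E} (ha : ¬ FractionEnds a) (n : ℕ) :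
    n + 1 ∈ indices a := by
  rw [mem_indices_succ]
  exact fun h => ha ((fractionEnds_iff a).2 ⟨_, h⟩)

theorem bounceTime_injective {a : Khat E} (ha : ¬ FractionEnds a) :
    Function.Injective (bounceTime a) :=
  (strictMono_nat_of_lt_succ fun n =>
    (bounceTime_lt_peakTime (mem_indices_of_not_fractionEnds ha n)).trans
      (peakTime_lt_bounceTime (mem_indices_of_not_fractionEnds ha n))).injective

theorem escapes_iff_fractionEnds (a : Khat E) :
    EscapesAfterFinitelyManyBounces (promenade a) ↔ FractionEnds a := by
  refine ⟨fun h => ?_, zeros_finite_and_tendsto_of_fractionEnds⟩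
  by_contra ha
  refine Set.infinite_range_of_injective (bounceTime_injective ha) (h.1.subset ?_)
  rintro _ ⟨n, rfl⟩
  exact promenade_bounceTime ha n

/-- The degrees of the coefficients of an infinite continued fraction do not form a convergent
series, although they need not have a common denominator. Below any bound `T` the promenade of `a` is that
of some `b ∈ k̃`, which has only finitely many zeros. -/
theorem exists_le_bounceTime {a : Khat E} (ha : ¬ FractionEnds a) (T : ℝ) :
    ∃ n, T ≤ bounceTime a n := by
  by_contra! hT
  obtain ⟨b, hb, hab⟩ := exists_mem_ktilde_near a T
  have hfin := (zeros_finite_and_tendsto_of_fractionEnds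
    ((fractionEnds_iff_mem_ktilde b).2 hb)).1
  refine Set.infinite_range_of_injective (bounceTime_injective ha) (hfin.subset ?_)
  rintro _ ⟨n, rfl⟩
  rw [Set.mem_ofPred_eq, ← promenade_bounceTime ha n]
  refine (promenade_congr (le_trans ?_ hab)).symm
  exact_mod_cast (hT n).le

/-! ### The local maxima of the promenade -/

theorem not_isLocalMax_abs (t : ℝ) : ¬ IsLocalMax (fun s : ℝ => |s|) t := by
  intro h
  obtain ⟨ε, hε, h⟩ := Metric.eventually_nhds_iff.1 h
  have h1 := @h (t + ε / 2) (by simp [abs_of_pos hε]; linarith)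
  have h2 := @h (t - ε / 2) (by simp [abs_of_pos hε]; linarith)
  rcases abs_cases t with h3 | h3
  · linarith [le_abs_self (t + ε / 2)]
  · linarith [neg_le_abs (t - ε / 2)]

theorem not_isLocalMax_of_eventually_eq_abs {w : ℝ → ℝ} {t : ℝ} (h : ∀ᶠ s in 𝓝 t, w s = |s|) :
    ¬ IsLocalMax w t := fun hw =>
  not_isLocalMax_abs t ((EventuallyEq.isLocalMax_iff h).1 hw)

theorem pos_of_isLocalMax {a : Khat E} {t : ℝ} (h : IsLocalMax (promenade a) t) : 0 < t := by
  by_contra! ht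
  obtain ⟨ε, hε, hw⟩ := exists_pos_promenade_eq_abs a
  refine not_isLocalMax_of_eventually_eq_abs ?_ h
  filter_upwards [eventually_lt_nhds (ht.trans_lt hε)] with s hs
  exact hw s hs.le

theorem isLocalMax_nextDeg {a : Khat E} (h : a - polyPart a ≠ 0) :
    IsLocalMax (promenade a) (nextDeg a) := by
  have hd := nextDeg_pos h
  obtain ⟨ε, hε, hw⟩ := exists_pos_promenade_eq_abs (1 / (a - polyPart a))
  have hmem : Set.Ioo 0 (2 * nextDeg a) ∈ 𝓝 (nextDeg a) := Ioo_mem_nhds hd (by linarith)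
  filter_upwards [hmem] with t ht
  rw [promenade_eq_abs_of_le h le_rfl, abs_of_pos hd]
  rcases le_total t (nextDeg a) with h' | h'
  · rwa [promenade_eq_abs_of_le h h', abs_of_pos ht.1]
  · rw [promenade_eq_next h h', hw _ (by linarith [ht.2]), abs_of_neg (by linarith [ht.2])]
    linarith

theorem isLocalMax_iff_next_of_lt {a : Khat E} (h : a - polyPart a ≠ 0) {t : ℝ}
    (ht : nextDeg a < t) :
    IsLocalMax (promenade a) t ↔
      IsLocalMax (promenade (1 / (a - polyPart a))) (t - 2 * nextDeg a) := by
  have h1 : promenade a =ᶠ[𝓝 t]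
      fun s => promenade (1 / (a - polyPart a)) (s - 2 * nextDeg a) := by
    filter_upwards [eventually_gt_nhds ht] with s hs
    exact promenade_eq_next h hs.le
  have h2 : map (fun s => s - 2 * nextDeg a) (𝓝 t) = 𝓝 (t - 2 * nextDeg a) :=
    (Homeomorph.subRight (2 * nextDeg a)).map_nhds_eq t
  rw [h1.isLocalMax_iff, IsLocalMax, IsLocalMax, IsMaxFilter, IsMaxFilter, ← h2, eventually_map]

theorem isLocalMax_iff_next {a : Khat E} (h : a - polyPart a ≠ 0) {t : ℝ} :
    IsLocalMax (promenade a) t ↔ t = nextDeg a ∨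
      IsLocalMax (promenade (1 / (a - polyPart a))) (t - 2 * nextDeg a) := by
  have hd := nextDeg_pos h
  constructor
  · intro hm
    rcases lt_trichotomy t (nextDeg a) with ht | ht | ht
    · refine absurd hm (not_isLocalMax_of_eventually_eq_abs ?_)
      filter_upwards [eventually_lt_nhds ht] with s hs
      exact promenade_eq_abs_of_le h hs.le
    · exact Or.inl ht
    · exact Or.inr ((isLocalMax_iff_next_of_lt h ht).1 hm)
  · rintro (rfl | hm)
    · exact isLocalMax_nextDeg h
    · exact (isLocalMax_iff_next_of_lt h (by linarith [pos_of_isLocalMax hm])).2 hm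

theorem ne_of_succ_mem_indices {a : Khat E} {n : ℕ} (h : n + 1 ∈ indices a) :
    a - polyPart a ≠ 0 := fun h0 =>
  mem_indices_succ.1 h (by rw [completeQuotient_succ, if_pos h0])

theorem mem_indices_next {a : Khat E} (h : a - polyPart a ≠ 0) {n : ℕ} :
    n + 1 ∈ indices (1 / (a - polyPart a)) ↔ n + 2 ∈ indices a := by
  rw [mem_indices_succ, mem_indices_succ, completeQuotient_succ_of_ne h]

theorem isLocalMax_peakTime {a : Khat E} {n : ℕ} (hn : n + 1 ∈ indices a) :
    IsLocalMax (promenade a) (peakTime a (n + 1)) := by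
  have h := ne_of_succ_mem_indices hn
  induction n generalizing a with
  | zero => exact (isLocalMax_iff_next h).2 (Or.inl (peakTime_one a))
  | succ n ih =>
    refine (isLocalMax_iff_next h).2 (Or.inr ?_)
    rw [peakTime_succ h, add_sub_cancel_right]
    have hn' := (mem_indices_next h).2 hn
    exact ih hn' (ne_of_succ_mem_indices hn')

theorem promenade_peakTime {a f : Khat E} {n : ℕ} (hf : coefficient a (n + 1) = some f) :
    ((promenade a (peakTime a (n + 1)) : ℝ) : EReal) = deg f := by
  have hn : n + 1 ∈ indices a := ⟨n.succ_pos, by rw [hf]; rfl⟩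
  have h := ne_of_succ_mem_indices hn
  induction n generalizing a with
  | zero =>
    rw [coefficient, completeQuotient_succ_of_ne h, completeQuotient, Option.map_some,
      Option.some_inj] at hf
    rw [← hf, deg_polyPart_next h, peakTime_one, promenade_eq_abs_of_le h le_rfl,
      abs_of_pos (nextDeg_pos h)]
  | succ n ih =>
    rw [coefficient, completeQuotient_succ_of_ne h, ← coefficient] at hf
    have hn' := (mem_indices_next h).2 hn
    have hpos := (bounceTime_nonneg _ _).trans_lt (bounceTime_lt_peakTime hn')
    rw [promenade_eq_next h (by rw [peakTime_succ h]; linarith [nextDeg_pos h]),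
      peakTime_succ h, add_sub_cancel_right]
    exact ih hf hn' (ne_of_succ_mem_indices hn')

/-- A local maximum is one of the first `n` peaks or a local maximum of the promenade of the `n`-th
complete quotient. -/
theorem exists_peakTime_eq_or {a : Khat E} {t : ℝ} (ht : IsLocalMax (promenade a) t) (n : ℕ) :
    (∃ i, i + 1 ∈ indices a ∧ peakTime a (i + 1) = t) ∨
      ∃ z, completeQuotient a n = some z ∧ IsLocalMax (promenade z) (t - bounceTime a n) := by
  induction n generalizing a t with
  | zero => exact Or.inr ⟨a, rfl, by rwa [bounceTime_zero, sub_zero]⟩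
  | succ n ih =>
    have h : a - polyPart a ≠ 0 := fun h =>
      not_isLocalMax_of_eventually_eq_abs (Eventually.of_forall (promenade_eq_abs_of_eq h)) ht
    rcases (isLocalMax_iff_next h).1 ht with rfl | ht'
    · refine Or.inl ⟨0, ?_, peakTime_one a⟩
      rw [mem_indices_succ, completeQuotient_succ_of_ne h]
      simp [completeQuotient]
    · rcases ih ht' with ⟨i, hi, hit⟩ | ⟨z, hz, hzt⟩
      · refine Or.inl ⟨i + 1, (mem_indices_next h).1 hi, ?_⟩
        rw [peakTime_succ h, hit, sub_add_cancel]
      · refine Or.inr ⟨z, by rw [completeQuotient_succ_of_ne h, hz], ?_⟩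
        convert hzt using 1
        rw [bounceTime_succ h]
        ring

theorem exists_peakTime_eq {a : Khat E} {t : ℝ} (ht : IsLocalMax (promenade a) t) :
    ∃ i, i + 1 ∈ indices a ∧ peakTime a (i + 1) = t := by
  by_cases ha : FractionEnds a
  · obtain ⟨n, hn⟩ := (fractionEnds_iff a).1 ha
    refine (exists_peakTime_eq_or ht n).resolve_right ?_
    rintro ⟨z, hz, -⟩
    rw [hn] at hz
    exact Option.some_ne_none z hz.symm
  · obtain ⟨n, hn⟩ := exists_le_bounceTime ha t
    refine (exists_peakTime_eq_or ht n).resolve_right ?_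
    rintro ⟨z, -, hz⟩
    linarith [pos_of_isLocalMax hz]

theorem image_peakTime_indices (a : Khat E) :
    peakTime a '' indices a = {t | IsLocalMax (promenade a) t} := by
  ext t
  constructor
  · rintro ⟨_ | n, hn, rfl⟩
    · exact absurd hn.1 (lt_irrefl _)
    · exact isLocalMax_peakTime hn
  · intro ht
    obtain ⟨i, hi, hit⟩ := exists_peakTime_eq ht
    exact ⟨i + 1, hi, hit⟩

end PuiseuxCF
end

theorem mainTheorem7 (E : Type*) [Field E] :
    Function.Bijective (PuiseuxCF.rayProj E) ∧
    ∀ a : PuiseuxCF.Khat E,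
      (∃ τ : ℕ → ℝ, StrictMonoOn τ (PuiseuxCF.indices a) ∧
        τ '' PuiseuxCF.indices a = {t | IsLocalMax (PuiseuxCF.promenade a) t} ∧
        ∀ i ∈ PuiseuxCF.indices a, ∀ f, PuiseuxCF.coefficient a i = some f →
          ((PuiseuxCF.promenade a (τ i) : ℝ) : EReal) = PuiseuxCF.deg f) ∧
      (PuiseuxCF.EscapesAfterFinitelyManyBounces (PuiseuxCF.promenade a) ↔
        PuiseuxCF.FractionEnds a) ∧
      (PuiseuxCF.FractionEnds a ↔ a ∈ PuiseuxCF.ktilde E) := by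
  refine ⟨PuiseuxCF.rayProj_bijective E, fun a => ⟨⟨PuiseuxCF.peakTime a,
    PuiseuxCF.strictMonoOn_peakTime a, PuiseuxCF.image_peakTime_indices a, ?_⟩,
    PuiseuxCF.escapes_iff_fractionEnds a, PuiseuxCF.fractionEnds_iff_mem_ktilde a⟩⟩
  rintro (_ | n) hn f hf
  · exact absurd hn.1 (lt_irrefl _)
  · exact PuiseuxCF.promenade_peakTime hf
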